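/- Let $n\ge 1$ and let $\mathcal G$ be a compact star graph with central vertex $v$ and edges $e_j=[v,v_j]$ of finite positive lengths, $j=1,\dots,n$. Let $p_j,q_j\in L^1(e_j,\mathbb R)$, $\alpha_j\in[0,\pi)$, and put $$J=\begin{pmatrix}0&-1\\1&0\end{pmatrix},\qquad V_j=\begin{pmatrix}p_j&q_j\\q_j&-p_j\end{pmatrix},\qquad H_j=-J\frac{d}{dx}+V_j .$$ For $\tau\in\mathbb R\cup\{\pm\infty\}$ let $\mathcal T_\tau$ be the operator in $\bigoplus_{j=1}^n\big(L^2(e_j)\oplus L^2(e_j)\big)$ that acts as $(\boldsymbol f_j)_1^n\mapsto(H_j\boldsymbol f_j)_1^n$ on the domain of all $\boldsymbol f=(\boldsymbol f_j)_1^n$, $\boldsymbol f_j=(f_j,\widehat f_j)^{\mathrm t}$, such that every $\boldsymbol f_j$ is absolutely continuous, $H_j\boldsymbol f_j\in L^2(e_j)\oplus L^2(e_j)$, $\cos\alpha_j\,f_j(v_j)+\sin\alpha_j\,\widehat f_j(v_j)=0$, and $$f_1(v)=\dots=f_n(v),\qquad f_1(v)=\tau\big(\widehat f_1(v)+\dots+\widehat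 f_n(v)\big);$$ for $\tau=\pm\infty$ the last equation is read as $\widehat f_1(v)+\dots+\widehat f_n(v)=0$. The multiplicity of an eigenvalue $z$ is $\dim\ker(\mathcal T_\tau-z)$. Let $Y_j(\cdot,z)=(y_{j,kl}(\cdot,z))_{k,l=1}^2$ be the solution of $-JY_j'+V_jY_j=zY_j$ on $e_j$ with $Y_j(v,z)=I_2$, and let $$m_j(z)=\frac{y_{j,11}(v_j,z)\cos\alpha_j+y_{j,21}(v_j,z)\sin\alpha_j}{y_{j,12}(v_j,z)\cos\alpha_j+y_{j,22}(v_j,z)\sin\alpha_j}$$ be the Weyl–Titchmarsh function of $e_j$, a meromorphic function on $\mathbb C$. A solution of the equation $$\sum_{j=1}^n m_j(z)=-\frac1\tau \qquad\Big(\frac1{\pm\infty}:=0\Big)\tag{1}$$ is a $z\in\mathbb C$ that is not a pole of any $m_j$ and satisfies (1). **Theorem.** For $\tau\in(\mathbb R\cup\{\pm\infty\})\setminus\{0\}$, a number $z\in\mathbb C$ is an eigenvalue of $\mathcal T_\tau$ if and only if it is a solution of (1) or a common pole of at least two of the functions $m_1,\dots,m_n$. Moreover: i) Every solution of (1) is a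 simple eigenvalue of $\mathcal T_\tau$. It is a strictly increasing function of $\tau$ on each of the intervals $I=[-\infty,0)$ and $I=(0,\infty]$: for $\tau_0\in I$ and every solution $z_0$ of (1) with $\tau=\tau_0$, there is exactly one continuous function $\lambda:I\to\mathbb R$ with $\lambda(\tau_0)=z_0$ such that $\lambda(\tau)$ is a solution of (1) for all $\tau\in I$, and this function $\lambda$ is strictly increasing. ii) If $\nu\ge1$ and $z$ is a pole of exactly $\nu+1$ of the functions $m_1,\dots,m_n$, then, for all $\tau\ne0$, $z$ is an eigenvalue of $\mathcal T_\tau$ of multiplicity $\nu$ (so these eigenvalues and their multiplicities do not depend on $\tau$). Further, for any $\tau_1,\tau_2\in\mathbb R\cup\{\pm\infty\}$ (the value $0$ is allowed), the eigenvalues of $\mathcal T_{\tau_1}$ and $\mathcal T_{\tau_2}$ interlace: all eigenvalues of $\mathcal T_{\tau_1}$ and of $\mathcal T_{\tau_2}$ are real and, counted with multiplicities, they can be listed as nondecreasing sequences $(a_k)_{k\in\mathbb Z}$ and $(b_k)_{k\in\mathbb Z}$, respectively, such that $a_k\le b_k\le a_{k+1}$ for all $k\in\mathbb Z$. -/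

import Mathlib

open MeasureTheory Set Matrix

noncomputable section

/-- A compact star graph with edges `e_j = [0, ℓ_j]`, `j : Fin n` (the central vertex is `0` on each
edge, the outer vertex `v_j` is `ℓ_j`), real potentials `p_j, q_j ∈ L¹(e_j)` and boundary parameters
`α_j ∈ [0, π)` at the outer vertices. -/
structure DiracStarGraph (n : ℕ) where
  ℓ : Fin n → ℝ
  p : Fin n → ℝ → ℝ
  q : Fin n → ℝ → ℝ
  α : Fin n → ℝ
  ℓ_pos : ∀ j, 0 < ℓ j
  p_integrable : ∀ j, IntegrableOn (p j) (Icc 0 (ℓ j))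
  q_integrable : ∀ j, IntegrableOn (q j) (Icc 0 (ℓ j))
  α_mem : ∀ j, α j ∈ Ico 0 Real.pi

namespace DiracStarGraph

variable {n : ℕ} (G : DiracStarGraph n)

/-- Lebesgue measure on the edge `e_j = [0, ℓ_j]`. -/
abbrev μ (j : Fin n) : Measure ℝ := volume.restrict (Icc 0 (G.ℓ j))

/-- The Hilbert space `L²(G) = ⨁_j (L²(e_j) ⊕ L²(e_j))`; the component `u j 0` is `f_j`,
the component `u j 1` is `f̂_j`. -/
abbrev H : Type := PiLp 2 (fun j : Fin n => PiLp 2 (fun _ : Fin 2 => Lp ℂ 2 (G.μ j)))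

/-- The matrix `J`. -/
def J : Matrix (Fin 2) (Fin 2) ℂ := !![0, -1; 1, 0]

/-- The potential matrix `V_j(x)`. -/
def V (j : Fin n) (x : ℝ) : Matrix (Fin 2) (Fin 2) ℂ :=
  !![(G.p j x : ℂ), (G.q j x : ℂ); (G.q j x : ℂ), -(G.p j x : ℂ)]

/-- The Dirac–Krein expression `(-J d/dx + V_j) f` at the point `x`. -/
def diracExpr (j : Fin n) (f : ℝ → Fin 2 → ℂ) (x : ℝ) : Fin 2 → ℂ :=
  -(J *ᵥ deriv f x) + G.V j x *ᵥ f x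

/-- The boundary condition `cos α_j f_j(v_j) + sin α_j f̂_j(v_j) = 0` at the outer vertex. -/
def OuterCondition (j : Fin n) (f : ℝ → Fin 2 → ℂ) : Prop :=
  (Real.cos (G.α j) : ℂ) * f (G.ℓ j) 0 + (Real.sin (G.α j) : ℂ) * f (G.ℓ j) 1 = 0

/-- The Robin matching condition with parameter `τ ∈ [-∞, ∞]` at the central vertex:
`f_1(v) = ⋯ = f_n(v)` and `f_1(v) = τ (f̂_1(v) + ⋯ + f̂_n(v))`, where `τ = ±∞` means
`f̂_1(v) + ⋯ + f̂_n(v) = 0` in the second condition. -/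
def RobinCondition (τ : EReal) (f : Fin n → ℝ → Fin 2 → ℂ) : Prop :=
  (∀ j k, f j 0 0 = f k 0 0) ∧
  ((τ ≠ ⊤ ∧ τ ≠ ⊥) → ∀ j, f j 0 0 = (τ.toReal : ℂ) * ∑ k, f k 0 1) ∧
  ((τ = ⊤ ∨ τ = ⊥) → ∑ k, f k 0 1 = 0)

/-- `w = T_τ u`, with `u` represented by the family `f` of absolutely continuous functions. -/
def IsRobinPair (τ : EReal) (u w : G.H) (f : Fin n → ℝ → Fin 2 → ℂ) : Prop :=
  (∀ j, AbsolutelyContinuousOnInterval (f j) 0 (G.ℓ j)) ∧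
  (∀ j i, (u j i : ℝ → ℂ) =ᵐ[G.μ j] fun x => f j x i) ∧
  (∀ j i, (w j i : ℝ → ℂ) =ᵐ[G.μ j] fun x => G.diracExpr j (f j) x i) ∧
  (∀ j, G.OuterCondition j (f j)) ∧
  RobinCondition τ f

theorem ae_Ioo (j : Fin n) : ∀ᵐ x ∂(G.μ j), x ∈ Ioo 0 (G.ℓ j) := by
  have h : G.μ j = volume.restrict (Ioo 0 (G.ℓ j)) := Measure.restrict_congr_set Ioo_ae_eq_Icc.symm
  rw [h]
  exact ae_restrict_mem measurableSet_Ioo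

/-- Absolutely continuous vector functions are differentiable almost everywhere. -/
theorem ae_differentiableAt (j : Fin n) {f : ℝ → Fin 2 → ℂ}
    (hf : AbsolutelyContinuousOnInterval f 0 (G.ℓ j)) :
    ∀ᵐ x ∂(G.μ j), DifferentiableAt ℝ f x := by
  have key : ∀ (L : (Fin 2 → ℂ) →L[ℝ] ℝ), ∀ᵐ x ∂(G.μ j),
      DifferentiableAt ℝ (fun x => L (f x)) x := by
    intro L
    have h1 : BoundedVariationOn (fun x => L (f x)) (uIcc 0 (G.ℓ j)) :=
      (L.lipschitz.lipschitzOnWith (s := univ)).comp_boundedVariationOn (mapsTo_univ _ _)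
        hf.boundedVariationOn
    have h2 := h1.locallyBoundedVariationOn.ae_differentiableWithinAt_of_mem
    filter_upwards [G.ae_Ioo j, ae_restrict_of_ae h2] with x hx h
    rw [uIcc_of_le (G.ℓ_pos j).le] at h
    exact (h ⟨hx.1.le, hx.2.le⟩).differentiableAt (Icc_mem_nhds hx.1 hx.2)
  have hre : ∀ i : Fin 2, ∀ᵐ x ∂(G.μ j), DifferentiableAt ℝ (fun x => (f x i).re) x := fun i =>
    key (Complex.reCLM.comp (ContinuousLinearMap.proj (R := ℝ) (φ := fun _ : Fin 2 => ℂ) i))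
  have him : ∀ i : Fin 2, ∀ᵐ x ∂(G.μ j), DifferentiableAt ℝ (fun x => (f x i).im) x := fun i =>
    key (Complex.imCLM.comp (ContinuousLinearMap.proj (R := ℝ) (φ := fun _ : Fin 2 => ℂ) i))
  filter_upwards [ae_all_iff.2 hre, ae_all_iff.2 him] with x h1 h2
  refine differentiableAt_pi.2 fun i => ?_
  have h3 : (fun x => f x i) = fun x =>
      Complex.equivRealProdCLM.symm ((f x i).re, (f x i).im) := by
    funext y; apply Complex.ext <;> simp
  rw [h3]
  exact Complex.equivRealProdCLM.symm.differentiableAt.comp x ((h1 i).prodMk (h2 i))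

/-- The graph `{(u, T_τ u)}` of the operator `T_τ`. -/
def robinGraph (τ : EReal) : Submodule ℂ (G.H × G.H) where
  carrier := {u | ∃ f, G.IsRobinPair τ u.1 u.2 f}
  zero_mem' := by
    refine ⟨fun _ _ => 0, fun j => ?_, fun j i => ?_, fun j i => ?_, fun j => ?_, ?_, ?_, ?_⟩
    · exact ((LipschitzWith.const (0 : Fin 2 → ℂ)).lipschitzOnWith).absolutelyContinuousOnInterval
    · exact Lp.coeFn_zero _ _ _
    · filter_upwards [Lp.coeFn_zero ℂ 2 (G.μ j)] with x hx
      simpa [diracExpr] using hx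
    · simp [OuterCondition]
    · simp
    · simp
    · simp
  add_mem' := by
    rintro u v ⟨f, hf1, hf2, hf3, hf4, hf5, hf6, hf7⟩ ⟨g, hg1, hg2, hg3, hg4, hg5, hg6, hg7⟩
    refine ⟨fun j x => f j x + g j x, fun j => ?_, fun j i => ?_, fun j i => ?_, fun j => ?_,
      fun j k => ?_, fun h j => ?_, fun h => ?_⟩
    · exact (hf1 j).add (hg1 j)
    · filter_upwards [hf2 j i, hg2 j i, Lp.coeFn_add (u.1 j i) (v.1 j i)] with x h1 h2 h3
      simpa [h1, h2] using h3
    · filter_upwards [hf3 j i, hg3 j i, Lp.coeFn_add (u.2 j i) (v.2 j i),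
        G.ae_differentiableAt j (hf1 j), G.ae_differentiableAt j (hg1 j)] with x h1 h2 h3 h4 h5
      refine h3.trans ?_
      rw [Pi.add_apply, h1, h2]
      simp only [diracExpr, deriv_fun_add h4 h5, mulVec_add, Pi.add_apply, Pi.neg_apply]
      ring
    · have h1 := hf4 j
      have h2 := hg4 j
      simp only [OuterCondition, Pi.add_apply] at *
      linear_combination h1 + h2
    · simp [hf5 j k, hg5 j k]
    · have h1 := hf6 h j
      have h2 := hg6 h j
      simp only [Pi.add_apply, Finset.sum_add_distrib]
      linear_combination h1 + h2
    · simp [Finset.sum_add_distrib, hf7 h, hg7 h]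
  smul_mem' := by
    rintro c u ⟨f, hf1, hf2, hf3, hf4, hf5, hf6, hf7⟩
    refine ⟨fun j x => c • f j x, fun j => ?_, fun j i => ?_, fun j i => ?_, fun j => ?_,
      fun j k => ?_, fun h j => ?_, fun h => ?_⟩
    · exact (hf1 j).const_smul c
    · filter_upwards [hf2 j i, Lp.coeFn_smul c (u.1 j i)] with x h1 h3
      simpa [h1] using h3
    · filter_upwards [hf3 j i, Lp.coeFn_smul c (u.2 j i),
        G.ae_differentiableAt j (hf1 j)] with x h1 h3 h4
      refine h3.trans ?_
      rw [Pi.smul_apply, h1]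
      simp only [diracExpr, deriv_fun_const_smul c h4, mulVec_smul, Pi.add_apply, Pi.neg_apply,
        Pi.smul_apply, smul_eq_mul]
      ring
    · have h1 := hf4 j
      simp only [OuterCondition, Pi.smul_apply, smul_eq_mul] at *
      linear_combination c * h1
    · simp [hf5 j k]
    · have h1 := hf6 h j
      simp only [Pi.smul_apply, smul_eq_mul, ← Finset.mul_sum]
      linear_combination c * h1
    · simp [← Finset.mul_sum, hf7 h]

theorem robinGraph_single_valued (τ : EReal) (u : G.H × G.H) (hu : u ∈ G.robinGraph τ)
    (h0 : u.1 = 0) : u.2 = 0 := by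
  obtain ⟨f, h1, h2, h3, -⟩ := hu
  ext1 j
  ext1 i
  have hz : ∀ i, (fun x => f j x i) =ᵐ[G.μ j] 0 := by
    intro i
    have h := h2 j i
    rw [h0] at h
    exact h.symm.trans (Lp.coeFn_zero _ _ _)
  have hcont : ContinuousOn (f j) (Icc 0 (G.ℓ j)) := by
    have := (h1 j).continuousOn
    rwa [uIcc_of_le (G.ℓ_pos j).le] at this
  have heq : ∀ i, EqOn (fun x => f j x i) (fun _ => 0) (Icc 0 (G.ℓ j)) := fun i =>
    Measure.eqOn_Icc_of_ae_eq volume (G.ℓ_pos j).ne (hz i)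
      ((continuous_apply i).comp_continuousOn hcont) continuousOn_const
  apply Lp.ext
  refine (h3 j i).trans (Filter.EventuallyEq.trans ?_ (Lp.coeFn_zero ℂ 2 (G.μ j)).symm)
  filter_upwards [G.ae_Ioo j] with x hx
  have hf0 : ∀ y ∈ Ioo 0 (G.ℓ j), f j y = 0 := fun y hy =>
    funext fun i => heq i ⟨hy.1.le, hy.2.le⟩
  have hd : deriv (f j) x = 0 := by
    have : f j =ᶠ[nhds x] fun _ => 0 := by
      filter_upwards [Ioo_mem_nhds hx.1 hx.2] with y hy using hf0 y hy
    rw [this.deriv_eq]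
    simp
  simp [diracExpr, hd, hf0 x hx]

/-- The operator `T_τ` in `L²(G)`: the Dirac–Krein expression on each edge, on the functions that
satisfy the outer boundary conditions and the Robin matching condition with parameter `τ`. -/
def T (τ : EReal) : G.H →ₗ.[ℂ] G.H := (G.robinGraph τ).toLinearPMap

theorem T_graph (τ : EReal) : (G.T τ).graph = G.robinGraph τ :=
  Submodule.toLinearPMap_graph_eq _ (G.robinGraph_single_valued τ)

/-- `Y` is a fundamental matrix on the edge `e_j`: `-J Y' + V_j Y = z Y`, `Y(v) = I₂`. -/
def IsFundamentalMatrix (j : Fin n) (z : ℂ) (Y : ℝ → Matrix (Fin 2) (Fin 2) ℂ) : Prop :=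
  Y 0 = 1 ∧ ∀ k, AbsolutelyContinuousOnInterval (fun x i => Y x i k) 0 (G.ℓ j) ∧
    ∀ᵐ x ∂(G.μ j), G.diracExpr j (fun x i => Y x i k) x = z • fun i => Y x i k

/-- The fundamental matrix `Y_j(·, z)` (it exists, and it is unique on the edge). -/
def Y (j : Fin n) (z : ℂ) : ℝ → Matrix (Fin 2) (Fin 2) ℂ :=
  Classical.epsilon (G.IsFundamentalMatrix j z)

/-- The numerator `b_j` of the Weyl–Titchmarsh function. -/
def b (j : Fin n) (z : ℂ) : ℂ :=
  G.Y j z (G.ℓ j) 0 0 * Real.cos (G.α j) + G.Y j z (G.ℓ j) 1 0 * Real.sin (G.α j)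

/-- The denominator `c_j` of the Weyl–Titchmarsh function. -/
def c (j : Fin n) (z : ℂ) : ℂ :=
  G.Y j z (G.ℓ j) 0 1 * Real.cos (G.α j) + G.Y j z (G.ℓ j) 1 1 * Real.sin (G.α j)

/-- The Weyl–Titchmarsh function `m_j` of the edge `e_j`, a meromorphic function on `ℂ`. -/
def m (j : Fin n) (z : ℂ) : ℂ := G.b j z / G.c j z

/-- `z` is a pole of `m_j`. -/
def IsPole (j : Fin n) (z : ℂ) : Prop := meromorphicOrderAt (G.m j) z < 0

/-- `z` solves `∑ m_j(z) = -1/τ`, with `1/(±∞) = 0`; in particular `z` is not a pole. -/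
def IsWeylSolution (τ : EReal) (z : ℂ) : Prop :=
  (∀ j, ¬ G.IsPole j z) ∧ ∑ j, G.m j z = -(((τ⁻¹).toReal : ℝ) : ℂ)

end DiracStarGraph

namespace LinearPMap

variable {E : Type*} [AddCommGroup E] [Module ℂ E]

/-- The space `ker (A - z)` for an operator `A` that need not be everywhere defined. -/
def eigenKer (A : E →ₗ.[ℂ] E) (z : ℂ) : Submodule ℂ A.domain :=
  LinearMap.ker (A.toFun - z • A.domain.subtype)

/-- `z` belongs to the point spectrum of `A`. -/
def IsEigenvalue (A : E →ₗ.[ℂ] E) (z : ℂ) : Prop := A.eigenKer z ≠ ⊥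

/-- The multiplicity `dim ker (A - z)`. -/
def multiplicity (A : E →ₗ.[ℂ] E) (z : ℂ) : ℕ∞ :=
  Cardinal.toENat (Module.rank ℂ (A.eigenKer z))

/-- `a` lists all eigenvalues of `A` in nondecreasing order, each as often as its multiplicity
(in particular they are real). -/
def IsEigenvalueEnumeration (A : E →ₗ.[ℂ] E) (a : ℤ → ℝ) : Prop :=
  Monotone a ∧ ∀ z : ℂ, {k : ℤ | (a k : ℂ) = z}.encard = A.multiplicity z

/-- The eigenvalues of `A` and `B`, counted with multiplicities, interlace. -/
def EigenvaluesInterlace (A B : E →ₗ.[ℂ] E) : Prop :=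
  ∃ a b : ℤ → ℝ, A.IsEigenvalueEnumeration a ∧ B.IsEigenvalueEnumeration b ∧
    ∀ k, a k ≤ b k ∧ b k ≤ a (k + 1)

end LinearPMap

end

/-! An eigenfunction is determined by its values at the central vertex, so `ker (T_τ - z)` is
isomorphic to the finite-dimensional space `vertexData`. There the outer condition on edge `j` reads
`a j 0 * b_j + a j 1 * c_j = 0`, where `b_j`, `c_j` are entire without common zeros, and the zeros
of `c_j` are the poles of `m_j`. If no `c_j` vanishes at `z`, the data are `(x, -m_j x)` with one
common `x`, and the matching condition for `τ ≠ 0` leaves `x` free exactly when `∑ m_j = -1/τ`. If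
`ν + 1` of the `c_j` vanish, the common value is forced to be zero, the data live on these edges,
and for `τ ≠ 0` their sum must vanish: dimension `ν`. For `τ = 0` the edges decouple and the
dimension is the number of vanishing `c_j`.

The rest is the behaviour of `m_j` on the real line. The Lagrange identity for the outer solutions
(`b_mul_c_sub`) makes `m_j` a Nevanlinna function: its poles are real, solutions of (1) are real,
and `m_j` has positive derivative off its poles. A Prüfer phase, which is a linear function of the
spectral parameter up to a bounded error, shows that the poles are unbounded in both directions.

Let `D` list all poles with multiplicity. On a nonempty gap `(D k, D (k + 1))` the sum `∑ m_j`
increases from `-∞` to `∞` and takes each real value exactly once; a degenerate gap `D k = D (k +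
1)` accounts for one of the `ν` copies of a multiple pole. Thus `T_τ`, `τ ≠ 0`, has exactly one
eigenvalue `B k` per gap, nondecreasing in the level `-1/τ`
(`IsIncreasingFamily.exists_interlacing`). Since every spectrum is listed relative to the same `D`,
any two of them interlace, possibly after an index shift. The branches in i) are the `B k` of
nondegenerate gaps composed with `τ ↦ -1/τ`, and a continuous competitor cannot leave its gap
because it never meets a pole. -/

noncomputable section

/-! ### Absolutely continuous vector-valued functions -/

section AbsCont

variable {X : Type*} [PseudoMetricSpace X] {X' : Type*} [PseudoMetricSpace X']

theorem AbsolutelyContinuousOnInterval.of_dist_le {f : ℝ → X} {g : ℝ → X'} {a b : ℝ} (C : ℝ)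
    (hg : AbsolutelyContinuousOnInterval g a b)
    (h : ∀ x ∈ uIcc a b, ∀ y ∈ uIcc a b, dist (f x) (f y) ≤ C * dist (g x) (g y)) :
    AbsolutelyContinuousOnInterval f a b := by
  have h0 := Filter.Tendsto.const_mul C hg
  rw [mul_zero] at h0
  refine squeeze_zero' (Filter.Eventually.of_forall fun E => Finset.sum_nonneg fun _ _ => dist_nonneg)
    ?_ h0
  refine Filter.eventually_inf_principal.2 (Filter.Eventually.of_forall fun E hE => ?_)
  rw [Finset.mul_sum]
  exact Finset.sum_le_sum fun i hi => h _ (hE.1 i hi).1 _ (hE.1 i hi).2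

variable {W : Type*} [NormedAddCommGroup W] [NormedSpace ℝ W]

theorem intervalIntegral_absolutelyContinuousOnInterval {g : ℝ → W} {a b : ℝ}
    (hg : IntervalIntegrable g volume a b) :
    AbsolutelyContinuousOnInterval (fun x => ∫ t in a..x, g t) a b := by
  refine (hg.norm.absolutelyContinuousOnInterval_intervalIntegral left_mem_uIcc).of_dist_le 1 ?_
  intro x hx y hy
  have hax := hg.mono_set (uIcc_subset_uIcc_left hx)
  have hay := hg.mono_set (uIcc_subset_uIcc_left hy)
  rw [dist_eq_norm, dist_eq_norm, intervalIntegral.integral_interval_sub_left hax hay,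
    intervalIntegral.integral_interval_sub_left hax.norm hay.norm, one_mul, Real.norm_eq_abs]
  exact intervalIntegral.norm_integral_le_abs_integral_norm

/-- Subtracting the primitive of `g` leaves an absolutely continuous function with derivative zero
almost everywhere, hence a constant. -/
theorem AbsolutelyContinuousOnInterval.integral_eq_sub_of_ae_hasDerivAt [CompleteSpace W]
    {f g : ℝ → W} {a b : ℝ}
    (hf : AbsolutelyContinuousOnInterval f a b) (hg : IntervalIntegrable g volume a b)
    (h : ∀ᵐ x, x ∈ uIcc a b → HasDerivAt f (g x) x) :
    ∫ x in a..b, g x = f b - f a := by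
  have h1 := hf.sub (intervalIntegral_absolutelyContinuousOnInterval hg)
  obtain ⟨C, hC⟩ := h1.const_of_ae_hasDerivAt_zero (by
    filter_upwards [h, hg.ae_hasDerivAt_integral] with x hx hx' hxm
    simpa using (hx hxm).sub (hx' hxm a left_mem_uIcc))
  have ha := hC a left_mem_uIcc
  have hb := hC b right_mem_uIcc
  simp only [Pi.sub_apply, intervalIntegral.integral_same, sub_zero] at ha hb
  rw [ha, ← hb]; abel

end AbsCont

/-! ### Volterra operators and invertibility of `1 - K` -/

section Volterra

variable {W : Type*} [NormedAddCommGroup W] [NormedSpace ℂ W]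

theorem IntervalIntegrable.clm_apply_of_continuousOn {A : ℝ → W →L[ℂ] W} {f : ℝ → W} {a b : ℝ}
    (hA : IntervalIntegrable A volume a b) (hf : ContinuousOn f (uIcc a b)) :
    IntervalIntegrable (fun t => A t (f t)) volume a b := by
  obtain ⟨C, hC⟩ := isCompact_uIcc.exists_bound_of_continuousOn hf
  rw [intervalIntegrable_iff] at hA ⊢
  have hm : AEStronglyMeasurable f (volume.restrict (uIoc a b)) :=
    (hf.mono uIoc_subset_uIcc).aestronglyMeasurable measurableSet_uIoc
  refine Integrable.mono' (hA.norm.mul_const C)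
    ((ContinuousLinearMap.id ℂ (W →L[ℂ] W)).aestronglyMeasurable_comp₂ hA.1 hm) ?_
  refine ae_restrict_of_forall_mem measurableSet_uIoc fun t ht => ?_
  exact (A t).le_opNorm_of_le (hC t (uIoc_subset_uIcc ht))

variable {ℓ : ℝ} (hl : 0 ≤ ℓ) {A : ℝ → W →L[ℂ] W} (hA : IntervalIntegrable A volume 0 ℓ)

theorem intervalIntegrable_clm_apply_IccExtend (hA : IntervalIntegrable A volume 0 ℓ)
    (f : C(Icc 0 ℓ, W)) {x : ℝ} (hx : x ∈ Icc 0 ℓ) :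
    IntervalIntegrable (fun t => A t (IccExtend hl f t)) volume 0 x :=
  (hA.clm_apply_of_continuousOn (f.continuous.Icc_extend' (h := hl)).continuousOn).mono_set
    (uIcc_subset_uIcc_left (by rwa [uIcc_of_le hl]))

theorem continuous_volterra_integral (hA : IntervalIntegrable A volume 0 ℓ) (f : C(Icc 0 ℓ, W)) :
    Continuous fun x : Icc 0 ℓ => ∫ t in (0 : ℝ)..x, A t (IccExtend hl f t) := by
  have h := intervalIntegrable_clm_apply_IccExtend hl hA f (right_mem_Icc.2 hl)
  have := intervalIntegral.continuousOn_primitive_interval (μ := volume)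
    ((intervalIntegrable_iff_integrableOn_Icc_of_le hl).1 h |>.mono_set (by rw [uIcc_of_le hl]))
  rw [uIcc_of_le hl] at this
  exact this.domRestrict

/-- The Volterra operator `f ↦ (x ↦ ∫₀ˣ A f)`. -/
def volterra : C(Icc 0 ℓ, W) →L[ℂ] C(Icc 0 ℓ, W) :=
  LinearMap.mkContinuous
    { toFun := fun f => ⟨fun x : Icc 0 ℓ => ∫ t in (0 : ℝ)..x, A t (IccExtend hl f t),
        continuous_volterra_integral hl hA f⟩
      map_add' := fun f g => by
        ext x
        refine Eq.trans ?_ (intervalIntegral.integral_add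
          (intervalIntegrable_clm_apply_IccExtend hl hA f x.2)
          (intervalIntegrable_clm_apply_IccExtend hl hA g x.2))
        simp [IccExtend]
      map_smul' := fun c f => by
        ext x
        refine Eq.trans ?_ (intervalIntegral.integral_smul c _)
        simp [IccExtend] }
    (∫ t in (0 : ℝ)..ℓ, ‖A t‖) fun f => by
      refine (ContinuousMap.norm_le _ (mul_nonneg (intervalIntegral.integral_nonneg hl
        fun _ _ => norm_nonneg _) (norm_nonneg _))).2 fun x => ?_
      have hx := hA.mono_set (uIcc_subset_uIcc_left (by rw [uIcc_of_le hl]; exact x.2))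
      refine (intervalIntegral.norm_integral_le_of_norm_le (g := fun t => ‖A t‖ * ‖f‖) x.2.1
        (Filter.Eventually.of_forall fun t _ => (A t).le_opNorm_of_le (f.norm_coe_le_norm _))
        (hx.norm.mul_const _)).trans ?_
      rw [intervalIntegral.integral_mul_const]
      refine mul_le_mul_of_nonneg_right ?_ (norm_nonneg _)
      exact intervalIntegral.integral_mono_interval le_rfl x.2.1 x.2.2
        (Filter.Eventually.of_forall fun _ => norm_nonneg _) hA.norm

theorem volterra_apply (f : C(Icc 0 ℓ, W)) (x : Icc 0 ℓ) :
    volterra hl hA f x = ∫ t in (0 : ℝ)..x, A t (IccExtend hl f t) := rfl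

/-- `∫₀ˣ k aⁿ = aⁿ⁺¹ / (n + 1)` for the primitive `a` of an integrable function `k`. -/
theorem integral_mul_primitive_pow {k : ℝ → ℝ} {x : ℝ} (hk : IntervalIntegrable k volume 0 x)
    (n : ℕ) :
    ∫ t in (0 : ℝ)..x, k t * (∫ s in (0 : ℝ)..t, k s) ^ n =
      (∫ s in (0 : ℝ)..x, k s) ^ (n + 1) / (n + 1) := by
  set a : ℝ → ℝ := fun t => ∫ s in (0 : ℝ)..t, k s with ha
  have hac : AbsolutelyContinuousOnInterval a 0 x :=
    intervalIntegral_absolutelyContinuousOnInterval hk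
  have hpow : ∀ m : ℕ, AbsolutelyContinuousOnInterval (fun t => a t ^ m) 0 x := by
    intro m
    induction m with
    | zero => simpa using (LipschitzWith.const (1 : ℝ)).lipschitzOnWith.absolutelyContinuousOnInterval
    | succ m ih => simpa only [pow_succ] using ih.fun_mul hac
  have h := (hpow (n + 1)).integral_eq_sub_of_ae_hasDerivAt
    (g := fun t => (n + 1) * (k t * a t ^ n))
    ((hk.mul_continuousOn (hpow n).continuousOn).const_mul _) (by
      filter_upwards [hk.ae_hasDerivAt_integral] with t ht htm
      have := (ht htm 0 left_mem_uIcc).pow (n + 1)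
      simp only [Nat.cast_add, Nat.cast_one, Nat.add_sub_cancel] at this
      exact this.congr_deriv (by simp only [ha]; ring))
  rw [intervalIntegral.integral_const_mul] at h
  have h0 : a 0 = 0 := by simp [ha]
  rw [h0, zero_pow n.succ_ne_zero, sub_zero] at h
  rw [eq_div_iff (by positivity), mul_comm, h]

/-- Iterating the integral bound gains a factorial, because the primitive of `k aⁿ` with `a' = k` is
`aⁿ⁺¹ / (n + 1)`. The bound must be pointwise in `x` for the induction to close. -/
theorem norm_volterra_pow_apply_le (n : ℕ) (f : C(Icc 0 ℓ, W)) (x : Icc 0 ℓ) :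
    ‖((volterra hl hA) ^ n) f x‖ ≤ (∫ t in (0 : ℝ)..x, ‖A t‖) ^ n / n.factorial * ‖f‖ := by
  induction n generalizing x with
  | zero => simpa using f.norm_coe_le_norm x
  | succ n ih =>
    have hx := hA.norm.mono_set (uIcc_subset_uIcc_left (by rw [uIcc_of_le hl]; exact x.2))
    have hac := (intervalIntegral_absolutelyContinuousOnInterval hx).continuousOn
    rw [pow_succ', mul_apply_eq_comp, volterra_apply]
    refine (intervalIntegral.norm_integral_le_of_norm_le
      (g := fun t => ‖A t‖ * (∫ s in (0 : ℝ)..t, ‖A s‖) ^ n * (‖f‖ / n.factorial)) x.2.1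
      (Filter.Eventually.of_forall fun t ht => ?_) ?_).trans ?_
    · have htm : t ∈ Icc 0 ℓ := ⟨ht.1.le, ht.2.trans x.2.2⟩
      refine ((A t).le_opNorm _).trans ?_
      rw [IccExtend_of_mem hl _ htm, mul_assoc]
      refine mul_le_mul_of_nonneg_left ((ih ⟨t, htm⟩).trans (le_of_eq ?_)) (norm_nonneg _)
      ring
    · exact (hx.mul_continuousOn (hac.pow n)).mul_const _
    · rw [intervalIntegral.integral_mul_const, integral_mul_primitive_pow hx, Nat.factorial_succ]
      refine le_of_eq ?_
      push_cast
      field_simp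

/-- The operator `K` need not be a contraction, but some power `Kⁿ` is; then `1 - Kⁿ` is invertible,
and so is its commuting factor `1 - K`. -/
theorem isUnit_one_sub_volterra [CompleteSpace W] : IsUnit (1 - volterra hl hA) := by
  obtain ⟨n, hn⟩ := ((FloorSemiring.tendsto_pow_div_factorial_atTop
    (∫ t in (0 : ℝ)..ℓ, ‖A t‖)).eventually_lt_const one_pos).exists
  have h1 : IsUnit (1 - volterra hl hA ^ n) := by
    refine isUnit_one_sub_of_norm_lt_one (x := volterra hl hA ^ n) (lt_of_le_of_lt ?_ hn)
    have h0 : ∀ x : ℝ, 0 ≤ x → 0 ≤ ∫ t in (0 : ℝ)..x, ‖A t‖ := fun x hx =>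
      intervalIntegral.integral_nonneg hx fun _ _ => norm_nonneg _
    refine ContinuousLinearMap.opNorm_le_bound _ (by have := h0 ℓ hl; positivity) fun f => ?_
    refine (ContinuousMap.norm_le _ (by have := h0 ℓ hl; positivity)).2 fun x => ?_
    refine (norm_volterra_pow_apply_le hl hA n f x).trans ?_
    gcongr
    · exact h0 x x.2.1
    · exact intervalIntegral.integral_mono_interval le_rfl x.2.1 x.2.2
        (Filter.Eventually.of_forall fun _ => norm_nonneg _) hA.norm
  rw [← mul_neg_geom_sum] at h1
  refine ((Commute.isUnit_mul_iff ?_).1 h1).1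
  exact Commute.sum_right _ _ _ fun i _ =>
    ((Commute.one_left _).sub_left (Commute.refl _)).pow_right i

end Volterra

/-! ### Linear systems with integrable coefficients: existence, uniqueness, dependence on `z` -/

section LinearODE

variable {W : Type*} [NormedAddCommGroup W] [NormedSpace ℂ W]
  {ℓ : ℝ} {A : ℝ → W →L[ℂ] W}

theorem differentiable_inverse_one_sub_add_smul {R : Type*} [NormedRing R] [NormedAlgebra ℂ R]
    [CompleteSpace R] {a b : R} (h : ∀ z : ℂ, IsUnit (1 - (a + z • b))) :
    Differentiable ℂ fun z : ℂ => Ring.inverse (1 - (a + z • b)) := by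
  intro z
  have h1 : DifferentiableAt ℂ (fun z : ℂ => 1 - (a + z • b)) z := by fun_prop
  exact (differentiableAt_inverse (𝕜 := ℂ) (h z)).fun_comp' z h1

theorem differentiable_inverse_one_sub_add_smul_apply {E : Type*} [NormedAddCommGroup E]
    [NormedSpace ℂ E] [CompleteSpace E] {a b : E →L[ℂ] E}
    (h : ∀ z : ℂ, IsUnit (1 - (a + z • b))) (e : E) :
    Differentiable ℂ fun z : ℂ => Ring.inverse (1 - (a + z • b)) e := fun z =>
  (differentiable_inverse_one_sub_add_smul h z).clm_apply (differentiableAt_const _)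

/-- The solution of `u' = (A₀ + z A₁) u`, `u(0) = w` is an entire function of `z`. -/
theorem exists_differentiable_solution [CompleteSpace W] (hl : 0 ≤ ℓ) {A₀ A₁ : ℝ → W →L[ℂ] W}
    (h₀ : IntervalIntegrable A₀ volume 0 ℓ) (h₁ : IntervalIntegrable A₁ volume 0 ℓ) (w : W) :
    ∃ u : ℂ → C(Icc 0 ℓ, W), Differentiable ℂ u ∧ ∀ z (x : Icc 0 ℓ),
      u z x = w + ∫ t in (0 : ℝ)..x, (A₀ t + z • A₁ t) (IccExtend hl (u z) t) := by
  have hz : ∀ z : ℂ, IntervalIntegrable (fun t => A₀ t + z • A₁ t) volume 0 ℓ := fun z =>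
    h₀.add (h₁.smul z)
  have hK : ∀ z : ℂ, volterra hl (hz z) = volterra hl h₀ + z • volterra hl h₁ := by
    intro z
    ext f x
    refine Eq.trans ?_ ((intervalIntegral.integral_add
      (intervalIntegrable_clm_apply_IccExtend hl h₀ f x.2)
      ((intervalIntegrable_clm_apply_IccExtend hl h₁ f x.2).smul z)).trans
        (congrArg _ (intervalIntegral.integral_smul z _)))
    rw [volterra_apply]
    rfl
  have hu : ∀ z : ℂ, IsUnit (1 - (volterra hl h₀ + z • volterra hl h₁)) := fun z =>
    hK z ▸ isUnit_one_sub_volterra hl (hz z)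
  -- The integral equation is `(1 - K₀ - z K₁) u = w`. Inverting it by an operator depending
  -- analytically on `z` gives a solution that is entire as a map into the continuous functions.
  refine ⟨fun z => Ring.inverse (1 - (volterra hl h₀ + z • volterra hl h₁))
    (ContinuousMap.const _ w), differentiable_inverse_one_sub_add_smul_apply hu _, fun z x => ?_⟩
  · have h2 := congrArg (fun T : C(Icc 0 ℓ, W) →L[ℂ] C(Icc 0 ℓ, W) => T (ContinuousMap.const _ w) x)
      (Ring.mul_inverse_cancel _ (hu z))
    simp only [mul_apply_eq_comp, ← hK] at h2 ⊢
    rw [← volterra_apply hl (hz z)]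
    simpa [sub_eq_iff_eq_add] using h2

theorem eqOn_zero_of_eq_integral [CompleteSpace W] (hl : 0 ≤ ℓ) (hA : IntervalIntegrable A volume 0 ℓ)
    {f : ℝ → W} (hf : ContinuousOn f (Icc 0 ℓ))
    (h : ∀ x ∈ Icc 0 ℓ, f x = ∫ t in (0 : ℝ)..x, A t (f t)) : EqOn f 0 (Icc 0 ℓ) := by
  let F : C(Icc 0 ℓ, W) := ⟨fun x => f x, hf.domRestrict⟩
  have h1 : (1 - volterra hl hA) F = 0 := by
    ext x
    rw [_root_.sub_apply, ContinuousMap.sub_apply, volterra_apply]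
    refine sub_eq_zero.2 ((h x x.2).trans (intervalIntegral.integral_congr fun t ht => ?_))
    rw [uIcc_of_le x.2.1] at ht
    have ht' : t ∈ Icc 0 ℓ := ⟨ht.1, ht.2.trans x.2.2⟩
    simp only [IccExtend_of_mem hl _ ht']
    rfl
  have h2 : F = 0 := by
    have := congrArg (fun T : C(Icc 0 ℓ, W) →L[ℂ] C(Icc 0 ℓ, W) => T F)
      (Ring.inverse_mul_cancel _ (isUnit_one_sub_volterra hl hA))
    simp only [mul_apply_eq_comp, h1, map_zero] at this
    exact this.symm
  intro x hx
  exact DFunLike.congr_fun h2 ⟨x, hx⟩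

/-- The difference solves the homogeneous Volterra equation, and `1 - K` is injective. -/
theorem eqOn_of_ae_hasDerivAt_clm [CompleteSpace W] (hl : 0 ≤ ℓ) (hA : IntervalIntegrable A volume 0 ℓ)
    {f g : ℝ → W} (hf : AbsolutelyContinuousOnInterval f 0 ℓ)
    (hg : AbsolutelyContinuousOnInterval g 0 ℓ)
    (hf' : ∀ᵐ x, x ∈ uIcc 0 ℓ → HasDerivAt f (A x (f x)) x)
    (hg' : ∀ᵐ x, x ∈ uIcc 0 ℓ → HasDerivAt g (A x (g x)) x) (h0 : f 0 = g 0) :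
    EqOn f g (Icc 0 ℓ) := by
  have hd := hf.sub hg
  have hc := hd.continuousOn
  have := eqOn_zero_of_eq_integral hl hA (f := f - g) (by rwa [uIcc_of_le hl] at hc) fun x hx => by
    have hsub : uIcc 0 x ⊆ uIcc 0 ℓ := uIcc_subset_uIcc_left (by rwa [uIcc_of_le hl])
    rw [(hd.mono hsub).integral_eq_sub_of_ae_hasDerivAt
      ((hA.clm_apply_of_continuousOn hc).mono_set hsub)]
    · simp [h0]
    · filter_upwards [hf', hg'] with t h1 h2 ht
      simpa using (h1 (hsub ht)).sub (h2 (hsub ht))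
  exact fun x hx => sub_eq_zero.1 (this hx)

theorem absolutelyContinuousOnInterval_of_eq_integral {g f : ℝ → W} {w : W}
    (hg : IntervalIntegrable g volume 0 ℓ)
    (h : ∀ x ∈ uIcc 0 ℓ, f x = w + ∫ t in (0 : ℝ)..x, g t) :
    AbsolutelyContinuousOnInterval f 0 ℓ :=
  (intervalIntegral_absolutelyContinuousOnInterval hg).of_dist_le 1 fun x hx y hy => by
    rw [h x hx, h y hy, one_mul, dist_add_left]

theorem AbsolutelyContinuousOnInterval.apply {ι : Type*} [Fintype ι] {E : ι → Type*}
    [∀ i, PseudoMetricSpace (E i)] {f : ℝ → ∀ i, E i} {a b : ℝ}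
    (hf : AbsolutelyContinuousOnInterval f a b) (i : ι) :
    AbsolutelyContinuousOnInterval (fun x => f x i) a b :=
  hf.of_dist_le 1 fun x _ y _ => by simpa using dist_le_pi_dist (f x) (f y) i

theorem AbsolutelyContinuousOnInterval.fun_mul_complex {f g : ℝ → ℂ} {a b : ℝ}
    (hf : AbsolutelyContinuousOnInterval f a b) (hg : AbsolutelyContinuousOnInterval g a b) :
    AbsolutelyContinuousOnInterval (fun x => f x * g x) a b :=
  hf.fun_smul hg

end LinearODE

/-! ### Solutions on one edge and the fundamental matrix -/

namespace DiracStarGraph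

variable {n : ℕ} (G : DiracStarGraph n) (j : Fin n)

/-- `f` solves `-J f' + V_j f = z f` on the edge `e_j`. -/
def IsSolution (z : ℂ) (f : ℝ → Fin 2 → ℂ) : Prop :=
  AbsolutelyContinuousOnInterval f 0 (G.ℓ j) ∧ ∀ᵐ x ∂(G.μ j), G.diracExpr j f x = z • f x

theorem ae_μ_iff {P : ℝ → Prop} : (∀ᵐ x ∂(G.μ j), P x) ↔ ∀ᵐ x, x ∈ uIcc 0 (G.ℓ j) → P x := by
  rw [uIcc_of_le (G.ℓ_pos j).le]
  exact ae_restrict_iff' measurableSet_Icc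

/-- The `z`-independent part of the coefficient of the first order system. -/
def coef (x : ℝ) : (Fin 2 → ℂ) →L[ℂ] (Fin 2 → ℂ) :=
  (G.p j x : ℂ) • (mulVecLin !![0, -1; -1, 0]).toContinuousLinearMap +
    (G.q j x : ℂ) • (mulVecLin !![1, 0; 0, -1]).toContinuousLinearMap

/-- The coefficient of the spectral parameter in the first order system. -/
def coefParam (_ : ℝ) : (Fin 2 → ℂ) →L[ℂ] (Fin 2 → ℂ) := (mulVecLin J).toContinuousLinearMap

theorem coef_apply (z : ℂ) (x : ℝ) (v : Fin 2 → ℂ) :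
    (G.coef j x + z • coefParam x) v =
      ![G.q j x * v 0 - (G.p j x + z) * v 1, (z - G.p j x) * v 0 - G.q j x * v 1] := by
  ext i
  fin_cases i <;>
    simp [coef, coefParam, J, dotProduct, Fin.sum_univ_two, -Fin.mk_one, -Fin.zero_eta] <;> ring

theorem intervalIntegrable_p : IntervalIntegrable (G.p j) volume 0 (G.ℓ j) :=
  (intervalIntegrable_iff_integrableOn_Icc_of_le (G.ℓ_pos j).le).2 (G.p_integrable j)

theorem intervalIntegrable_q : IntervalIntegrable (G.q j) volume 0 (G.ℓ j) :=
  (intervalIntegrable_iff_integrableOn_Icc_of_le (G.ℓ_pos j).le).2 (G.q_integrable j)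

theorem intervalIntegrable_coef : IntervalIntegrable (G.coef j) volume 0 (G.ℓ j) := by
  have h : ∀ {f : ℝ → ℝ} (B : (Fin 2 → ℂ) →L[ℂ] (Fin 2 → ℂ)),
      IntervalIntegrable f volume 0 (G.ℓ j) →
      IntervalIntegrable (fun x => (f x : ℂ) • B) volume 0 (G.ℓ j) := fun B hf =>
    ⟨(Integrable.ofReal hf.1).smul_const B, (Integrable.ofReal hf.2).smul_const B⟩
  exact (h _ (G.intervalIntegrable_p j)).add (h _ (G.intervalIntegrable_q j))

theorem intervalIntegrable_coefParam : IntervalIntegrable coefParam volume 0 (G.ℓ j) :=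
  intervalIntegrable_const

variable {G j} {z w : ℂ} {f g : ℝ → Fin 2 → ℂ}

/-- As `J² = -1`, the equation `-J f' + V f = z f` is `f' = J (z - V) f`; `coef` is `-J V` and
`coefParam` is `J`. -/
theorem diracExpr_eq_iff {x : ℝ} (hf : DifferentiableAt ℝ f x) :
    G.diracExpr j f x = z • f x ↔ HasDerivAt f ((G.coef j x + z • coefParam x) (f x)) x := by
  have h1 : HasDerivAt f ((G.coef j x + z • coefParam x) (f x)) x ↔
      deriv f x = (G.coef j x + z • coefParam x) (f x) :=
    ⟨fun h => h.deriv, fun h => h ▸ hf.hasDerivAt⟩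
  rw [h1, coef_apply, funext_iff, funext_iff, Fin.forall_fin_two, Fin.forall_fin_two]
  simp only [diracExpr, J, V, mulVec, dotProduct, Fin.sum_univ_two, Pi.add_apply, Pi.neg_apply,
    of_apply, cons_val_zero, cons_val_one, Pi.smul_apply, smul_eq_mul]
  constructor
  · rintro ⟨h, h'⟩
    exact ⟨by linear_combination -h', by linear_combination h⟩
  · rintro ⟨h, h'⟩
    exact ⟨by linear_combination h', by linear_combination -h⟩

theorem IsSolution.ae_hasDerivAt (hf : G.IsSolution j z f) :
    ∀ᵐ x, x ∈ uIcc 0 (G.ℓ j) → HasDerivAt f ((G.coef j x + z • coefParam x) (f x)) x := by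
  rw [← ae_μ_iff]
  filter_upwards [hf.2, G.ae_differentiableAt j hf.1] with x h1 h2
  exact (diracExpr_eq_iff h2).1 h1

theorem isSolution_of_ae_hasDerivAt (hf : AbsolutelyContinuousOnInterval f 0 (G.ℓ j))
    (h : ∀ᵐ x, x ∈ uIcc 0 (G.ℓ j) → HasDerivAt f ((G.coef j x + z • coefParam x) (f x)) x) :
    G.IsSolution j z f := by
  rw [← ae_μ_iff] at h
  refine ⟨hf, ?_⟩
  filter_upwards [h] with x hx
  exact (diracExpr_eq_iff hx.differentiableAt).2 hx

theorem IsSolution.continuousOn (hf : G.IsSolution j z f) : ContinuousOn f (Icc 0 (G.ℓ j)) := by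
  have := hf.1.continuousOn
  rwa [uIcc_of_le (G.ℓ_pos j).le] at this

theorem IsSolution.eqOn (hf : G.IsSolution j z f) (hg : G.IsSolution j z g) (h0 : f 0 = g 0) :
    EqOn f g (Icc 0 (G.ℓ j)) :=
  eqOn_of_ae_hasDerivAt_clm (G.ℓ_pos j).le
    ((G.intervalIntegrable_coef j).add ((G.intervalIntegrable_coefParam j).smul z)) hf.1 hg.1
    hf.ae_hasDerivAt hg.ae_hasDerivAt h0

theorem IsSolution.add (hf : G.IsSolution j z f) (hg : G.IsSolution j z g) :
    G.IsSolution j z (fun x => f x + g x) :=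
  isSolution_of_ae_hasDerivAt (hf.1.add hg.1) (by
    filter_upwards [hf.ae_hasDerivAt, hg.ae_hasDerivAt] with x h1 h2 hx
    rw [map_add]
    exact (h1 hx).add (h2 hx))

theorem IsSolution.const_smul (hf : G.IsSolution j z f) (c : ℂ) :
    G.IsSolution j z (fun x => c • f x) :=
  isSolution_of_ae_hasDerivAt (hf.1.const_smul c) (by
    filter_upwards [hf.ae_hasDerivAt] with x h1 hx
    rw [map_smul]
    exact (h1 hx).const_smul c)

variable (G j)

theorem exists_isSolution (a : Fin 2 → ℂ) :
    ∃ u : ℂ → C(Icc 0 (G.ℓ j), Fin 2 → ℂ), Differentiable ℂ u ∧ ∀ z,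
      IccExtend (G.ℓ_pos j).le (u z) 0 = a ∧
      G.IsSolution j z (IccExtend (G.ℓ_pos j).le (u z)) := by
  have hl := (G.ℓ_pos j).le
  obtain ⟨u, hu, h⟩ := exists_differentiable_solution hl (G.intervalIntegrable_coef j)
    (G.intervalIntegrable_coefParam j) a
  refine ⟨u, hu, fun z => ?_⟩
  have hA := (G.intervalIntegrable_coef j).add ((G.intervalIntegrable_coefParam j).smul z)
  have hg := hA.clm_apply_of_continuousOn ((u z).continuous.Icc_extend' (h := hl)).continuousOn
  have h' : ∀ x ∈ uIcc 0 (G.ℓ j), IccExtend hl (u z) x =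
      a + ∫ t in (0 : ℝ)..x, (G.coef j t + z • coefParam t) (IccExtend hl (u z) t) := by
    intro x hx
    rw [uIcc_of_le hl] at hx
    rw [IccExtend_of_mem hl _ hx, h z ⟨x, hx⟩]
  refine ⟨by simpa using h' 0 left_mem_uIcc, isSolution_of_ae_hasDerivAt
    (absolutelyContinuousOnInterval_of_eq_integral hg h') ?_⟩
  -- The extension is constant outside the edge, so it agrees with the integral formula in a
  -- neighbourhood only of interior points.
  have hne : ∀ᵐ x : ℝ, x ≠ 0 ∧ x ≠ G.ℓ j := by
    filter_upwards [Measure.ae_ne volume (0 : ℝ), Measure.ae_ne volume (G.ℓ j)] with x h1 h2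
      using ⟨h1, h2⟩
  filter_upwards [hg.ae_hasDerivAt_integral, hne] with x hx hne hxm
  refine ((hx hxm 0 left_mem_uIcc).const_add a).congr_of_eventuallyEq ?_
  rw [uIcc_of_le hl] at hxm h'
  filter_upwards [Icc_mem_nhds (hxm.1.lt_of_ne hne.1.symm) (hxm.2.lt_of_ne hne.2)] with y hy
    using h' y hy

theorem isFundamentalMatrix_Y (z : ℂ) : G.IsFundamentalMatrix j z (G.Y j z) := by
  refine Classical.epsilon_spec (p := G.IsFundamentalMatrix j z) ?_
  choose u _ hu using fun k : Fin 2 => G.exists_isSolution j (Pi.single k 1)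
  refine ⟨fun x => of fun i k => IccExtend (G.ℓ_pos j).le (u k z) x i, ?_, fun k => (hu k z).2⟩
  ext i k
  simp only [of_apply, (hu k z).1, Pi.single_apply, one_apply]

/-- The `k`-th column of the fundamental matrix. -/
def col (k : Fin 2) (z : ℂ) (x : ℝ) : Fin 2 → ℂ := fun i => G.Y j z x i k

theorem col_zero (k : Fin 2) (z : ℂ) : G.col j k z 0 = Pi.single k 1 := by
  ext i
  simp [col, (G.isFundamentalMatrix_Y j z).1, one_apply, Pi.single_apply]

theorem isSolution_col (k : Fin 2) (z : ℂ) : G.IsSolution j z (G.col j k z) :=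
  (G.isFundamentalMatrix_Y j z).2 k

theorem exists_differentiable_col (k : Fin 2) :
    ∃ u : ℂ → C(Icc 0 (G.ℓ j), Fin 2 → ℂ), Differentiable ℂ u ∧
      ∀ z (x : Icc 0 (G.ℓ j)), u z x = G.col j k z x := by
  obtain ⟨u, hu, h⟩ := G.exists_isSolution j (Pi.single k 1)
  refine ⟨u, hu, fun z x => ?_⟩
  rw [← (h z).2.eqOn (G.isSolution_col j k z) ((h z).1.trans (G.col_zero j k z).symm) x.2,
    IccExtend_of_mem _ _ x.2]

theorem differentiable_col {x : ℝ} (hx : x ∈ Icc 0 (G.ℓ j)) (k i : Fin 2) :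
    Differentiable ℂ fun z => G.col j k z x i := by
  obtain ⟨u, hu, h⟩ := G.exists_differentiable_col j k
  have h1 : (fun z => G.col j k z x i) = fun z =>
      (ContinuousLinearMap.proj (R := ℂ) (φ := fun _ : Fin 2 => ℂ) i)
        (ContinuousMap.evalCLM ℂ (⟨x, hx⟩ : Icc 0 (G.ℓ j)) (u z)) := by
    ext z
    simp [h]
  rw [h1]
  fun_prop

/-- The solution with initial value `a`. -/
def solution (z : ℂ) (a : Fin 2 → ℂ) (x : ℝ) : Fin 2 → ℂ :=
  a 0 • G.col j 0 z x + a 1 • G.col j 1 z x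

theorem isSolution_solution (z : ℂ) (a : Fin 2 → ℂ) : G.IsSolution j z (G.solution j z a) :=
  ((G.isSolution_col j 0 z).const_smul _).add ((G.isSolution_col j 1 z).const_smul _)

theorem solution_zero (z : ℂ) (a : Fin 2 → ℂ) : G.solution j z a 0 = a := by
  ext i
  fin_cases i <;> simp [solution, col_zero]

variable {G j}

theorem IsSolution.eqOn_solution (hf : G.IsSolution j z f) :
    EqOn f (G.solution j z (f 0)) (Icc 0 (G.ℓ j)) :=
  hf.eqOn (G.isSolution_solution j z _) (G.solution_zero j z _).symm

/-- **Lagrange identity**. -/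
theorem IsSolution.lagrange (hf : G.IsSolution j z f) (hg : G.IsSolution j w g) {x : ℝ}
    (hx : x ∈ Icc 0 (G.ℓ j)) :
    (f x 1 * g x 0 - f x 0 * g x 1) - (f 0 1 * g 0 0 - f 0 0 * g 0 1) =
      (z - w) * ∫ t in (0 : ℝ)..x, (f t 0 * g t 0 + f t 1 * g t 1) := by
  have hl := (G.ℓ_pos j).le
  have hsub : uIcc 0 x ⊆ uIcc 0 (G.ℓ j) := uIcc_subset_uIcc_left (by rwa [uIcc_of_le hl])
  have hcomp : ∀ h : ℝ → Fin 2 → ℂ, AbsolutelyContinuousOnInterval h 0 (G.ℓ j) → ∀ i : Fin 2,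
      AbsolutelyContinuousOnInterval (fun t => h t i) 0 x := fun h hh i =>
    (hh.mono hsub).apply i
  have hF : AbsolutelyContinuousOnInterval (fun t => f t 1 * g t 0 - f t 0 * g t 1) 0 x :=
    ((hcomp f hf.1 1).fun_mul_complex (hcomp g hg.1 0)).fun_sub ((hcomp f hf.1 0).fun_mul_complex (hcomp g hg.1 1))
  rw [← intervalIntegral.integral_const_mul]
  have hc : IntervalIntegrable (fun t => (z - w) * (f t 0 * g t 0 + f t 1 * g t 1)) volume 0 x := by
    refine ContinuousOn.intervalIntegrable ?_
    have h1 := fun i => (hcomp f hf.1 i).continuousOn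
    have h2 := fun i => (hcomp g hg.1 i).continuousOn
    exact continuousOn_const.mul (((h1 0).mul (h2 0)).add ((h1 1).mul (h2 1)))
  have hd : ∀ᵐ t, t ∈ uIcc 0 x → HasDerivAt (fun t => f t 1 * g t 0 - f t 0 * g t 1)
      ((z - w) * (f t 0 * g t 0 + f t 1 * g t 1)) t := by
    filter_upwards [hf.ae_hasDerivAt, hg.ae_hasDerivAt] with t h1 h2 ht
    have h1' := hasDerivAt_pi.1 (h1 (hsub ht))
    have h2' := hasDerivAt_pi.1 (h2 (hsub ht))
    -- The potential is a symmetric matrix, so its contributions to the derivative of the bracket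
    -- cancel; only the difference of the spectral parameters remains.
    refine (((h1' 1).fun_mul (h2' 0)).fun_sub ((h1' 0).fun_mul (h2' 1))).congr_deriv ?_
    simp only [coef_apply, cons_val_zero, cons_val_one]
    ring
  exact (hF.integral_eq_sub_of_ae_hasDerivAt hc hd).symm

end DiracStarGraph

/-! ### The Weyl–Titchmarsh functions -/

namespace DiracStarGraph

open scoped ComplexConjugate

variable {n : ℕ} {G : DiracStarGraph n} {j : Fin n} {z w : ℂ} {f g : ℝ → Fin 2 → ℂ}

theorem IsSolution.conj (hf : G.IsSolution j z f) :
    G.IsSolution j (conj z) (fun x i => conj (f x i)) := by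
  refine isSolution_of_ae_hasDerivAt (hf.1.of_dist_le 1 fun x _ y _ => ?_) ?_
  · rw [one_mul]
    refine (dist_pi_le_iff dist_nonneg).2 fun i => ?_
    rw [Complex.dist_conj_conj]
    exact dist_le_pi_dist _ _ i
  · filter_upwards [hf.ae_hasDerivAt] with x hx hxm
    refine hasDerivAt_pi.2 fun i => ?_
    refine ((hasDerivAt_pi.1 (hx hxm) i).star).congr_deriv ?_
    rw [coef_apply, coef_apply]
    fin_cases i <;> simp

/-- Both boundary values are annihilated by the same nonzero row `(cos α, sin α)`, hence they are
linearly dependent. -/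
theorem OuterCondition.wronskian_eq_zero (hf : G.OuterCondition j f) (hg : G.OuterCondition j g) :
    f (G.ℓ j) 1 * g (G.ℓ j) 0 - f (G.ℓ j) 0 * g (G.ℓ j) 1 = 0 := by
  have h : (Real.cos (G.α j) : ℂ) ^ 2 + (Real.sin (G.α j) : ℂ) ^ 2 = 1 := by
    exact_mod_cast Real.cos_sq_add_sin_sq (G.α j)
  simp only [OuterCondition] at hf hg
  set C := (Real.cos (G.α j) : ℂ)
  set S := (Real.sin (G.α j) : ℂ)
  linear_combination (-(f (G.ℓ j) 1 * g (G.ℓ j) 0 - f (G.ℓ j) 0 * g (G.ℓ j) 1)) * h +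
    (C * f (G.ℓ j) 1 - S * f (G.ℓ j) 0) * hg - (C * g (G.ℓ j) 1 - S * g (G.ℓ j) 0) * hf

theorem integral_normSq_pos (hf : ContinuousOn f (Icc 0 (G.ℓ j))) (h0 : f 0 ≠ 0) :
    0 < ∫ t in (0 : ℝ)..G.ℓ j, (Complex.normSq (f t 0) + Complex.normSq (f t 1)) := by
  have hi : ∀ i, ContinuousOn (fun t => Complex.normSq (f t i)) (Icc 0 (G.ℓ j)) := fun i =>
    Complex.continuous_normSq.comp_continuousOn ((continuous_apply i).comp_continuousOn hf)
  refine intervalIntegral.integral_pos (G.ℓ_pos j) ((hi 0).add (hi 1))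
    (fun t _ => add_nonneg (Complex.normSq_nonneg _) (Complex.normSq_nonneg _))
    ⟨0, left_mem_Icc.2 (G.ℓ_pos j).le, ?_⟩
  by_contra hle
  have h1 := Complex.normSq_nonneg (f 0 0)
  have h2 := Complex.normSq_nonneg (f 0 1)
  exact h0 (funext (Fin.forall_fin_two.2 ⟨Complex.normSq_eq_zero.1 (by linarith),
    Complex.normSq_eq_zero.1 (by linarith)⟩))

variable (G j)

theorem b_eq (z : ℂ) : G.b j z =
    Real.cos (G.α j) * G.col j 0 z (G.ℓ j) 0 + Real.sin (G.α j) * G.col j 0 z (G.ℓ j) 1 := by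
  simp only [b, col]; ring

theorem c_eq (z : ℂ) : G.c j z =
    Real.cos (G.α j) * G.col j 1 z (G.ℓ j) 0 + Real.sin (G.α j) * G.col j 1 z (G.ℓ j) 1 := by
  simp only [c, col]; ring

theorem outerCondition_solution (z : ℂ) (a : Fin 2 → ℂ) :
    G.OuterCondition j (G.solution j z a) ↔ a 0 * G.b j z + a 1 * G.c j z = 0 := by
  rw [b_eq, c_eq, OuterCondition]
  simp only [solution, Pi.add_apply, Pi.smul_apply, smul_eq_mul]
  constructor <;> intro h <;> linear_combination h

theorem differentiable_b : Differentiable ℂ (G.b j) := by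
  have h := G.differentiable_col j (right_mem_Icc.2 (G.ℓ_pos j).le)
  have : G.b j = fun z => _ := funext (G.b_eq j)
  rw [this]
  exact ((h 0 0).const_mul _).add ((h 0 1).const_mul _)

theorem differentiable_c : Differentiable ℂ (G.c j) := by
  have h := G.differentiable_col j (right_mem_Icc.2 (G.ℓ_pos j).le)
  have : G.c j = fun z => _ := funext (G.c_eq j)
  rw [this]
  exact ((h 1 0).const_mul _).add ((h 1 1).const_mul _)

/-- The Lagrange identity with equal spectral parameters: the Wronskian is constant. -/
theorem det_col (z : ℂ) {x : ℝ} (hx : x ∈ Icc 0 (G.ℓ j)) :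
    G.col j 0 z x 0 * G.col j 1 z x 1 - G.col j 0 z x 1 * G.col j 1 z x 0 = 1 := by
  have := (G.isSolution_col j 0 z).lagrange (G.isSolution_col j 1 z) hx
  simp only [col_zero, sub_self, zero_mul] at this
  simp at this
  linear_combination -this

/-- The row `(b, c)` is `(cos α, sin α)` times a matrix of determinant one, so it cannot vanish. -/
theorem b_ne_zero_of_c_eq_zero (hc : G.c j z = 0) : G.b j z ≠ 0 := by
  intro hb
  have hd := G.det_col j z (right_mem_Icc.2 (G.ℓ_pos j).le)
  rw [b_eq] at hb
  rw [c_eq] at hc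
  have h : (Real.cos (G.α j) : ℂ) ^ 2 + (Real.sin (G.α j) : ℂ) ^ 2 = 1 := by
    exact_mod_cast Real.cos_sq_add_sin_sq (G.α j)
  set C := (Real.cos (G.α j) : ℂ)
  set S := (Real.sin (G.α j) : ℂ)
  have hC : C = 0 := by
    linear_combination G.col j 1 z (G.ℓ j) 1 * hb - G.col j 0 z (G.ℓ j) 1 * hc - C * hd
  have hS : S = 0 := by
    linear_combination G.col j 0 z (G.ℓ j) 0 * hc - G.col j 1 z (G.ℓ j) 0 * hb - S * hd
  rw [hC, hS] at h
  norm_num at h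

theorem col_conj (k : Fin 2) (z : ℂ) {x : ℝ} (hx : x ∈ Icc 0 (G.ℓ j)) (i : Fin 2) :
    G.col j k (conj z) x i = conj (G.col j k z x i) := by
  refine congrFun ((G.isSolution_col j k (conj z)).eqOn (G.isSolution_col j k z).conj ?_ hx) i
  ext i
  simp only [col_zero, Pi.single_apply]
  split_ifs <;> simp

theorem b_conj (z : ℂ) : G.b j (conj z) = conj (G.b j z) := by
  have h := G.col_conj j 0 z (right_mem_Icc.2 (G.ℓ_pos j).le)
  rw [b_eq, b_eq, h, h]
  simp only [map_add, map_mul, Complex.conj_ofReal]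

theorem c_conj (z : ℂ) : G.c j (conj z) = conj (G.c j z) := by
  have h := G.col_conj j 1 z (right_mem_Icc.2 (G.ℓ_pos j).le)
  rw [c_eq, c_eq, h, h]
  simp only [map_add, map_mul, Complex.conj_ofReal]

/-- The solution that satisfies the outer boundary condition, normalised so as to be entire
in `z`. -/
def outerSolution (z : ℂ) : ℝ → Fin 2 → ℂ := G.solution j z ![G.c j z, -G.b j z]

theorem isSolution_outerSolution (z : ℂ) : G.IsSolution j z (G.outerSolution j z) :=
  G.isSolution_solution j z _

theorem outerSolution_zero (z : ℂ) : G.outerSolution j z 0 = ![G.c j z, -G.b j z] :=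
  G.solution_zero j z _

theorem outerSolution_zero_ne_zero (z : ℂ) : G.outerSolution j z 0 ≠ 0 := by
  rw [outerSolution_zero]
  intro h
  have h0 := congrFun h 0
  have h1 := congrFun h 1
  simp only [cons_val_zero, cons_val_one, Pi.zero_apply, neg_eq_zero] at h0 h1
  exact G.b_ne_zero_of_c_eq_zero j h0 h1

theorem outerCondition_outerSolution (z : ℂ) : G.OuterCondition j (G.outerSolution j z) := by
  rw [outerSolution, outerCondition_solution]
  simp only [cons_val_zero, cons_val_one]
  ring

theorem outerSolution_conj (z : ℂ) {x : ℝ} (hx : x ∈ Icc 0 (G.ℓ j)) (i : Fin 2) :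
    G.outerSolution j (conj z) x i = conj (G.outerSolution j z x i) := by
  simp only [outerSolution, solution, Pi.add_apply, Pi.smul_apply, smul_eq_mul, cons_val_zero,
    cons_val_one, G.col_conj j _ z hx, b_conj, c_conj, map_add, map_mul, map_neg]

/-- The bilinear pairing of two normalised outer solutions. -/
def outerPairing (z w : ℂ) : ℂ :=
  ∫ t in (0 : ℝ)..G.ℓ j, (G.outerSolution j z t 0 * G.outerSolution j w t 0 +
    G.outerSolution j z t 1 * G.outerSolution j w t 1)

/-- In the Lagrange identity for two outer solutions the term at the outer vertex drops out. Taking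
`w = conj z` yields the Nevanlinna property, and dividing by `w - z` yields the derivative of `m_j`.
-/
theorem b_mul_c_sub (z w : ℂ) :
    G.b j w * G.c j z - G.b j z * G.c j w = (w - z) * G.outerPairing j z w := by
  have h := (G.isSolution_outerSolution j z).lagrange (G.isSolution_outerSolution j w)
    (right_mem_Icc.2 (G.ℓ_pos j).le)
  rw [(G.outerCondition_outerSolution j z).wronskian_eq_zero (G.outerCondition_outerSolution j w),
    outerSolution_zero, outerSolution_zero] at h
  simp only [cons_val_zero, cons_val_one] at h
  rw [outerPairing]
  linear_combination -h

theorem exists_outerPairing_conj (z : ℂ) : ∃ K : ℝ, 0 < K ∧ G.outerPairing j z (conj z) = K := by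
  refine ⟨_, integral_normSq_pos (G.isSolution_outerSolution j z).continuousOn
    (G.outerSolution_zero_ne_zero j z), ?_⟩
  rw [outerPairing, ← intervalIntegral.integral_ofReal]
  refine intervalIntegral.integral_congr fun t ht => ?_
  rw [uIcc_of_le (G.ℓ_pos j).le] at ht
  simp only [G.outerSolution_conj j z ht, Complex.mul_conj]
  push_cast
  rfl

/-- Used to let `w → z` in the difference quotient of `m_j`. -/
theorem continuous_outerPairing (z : ℂ) : Continuous fun w => G.outerPairing j z w := by
  have hl := (G.ℓ_pos j).le
  choose u hu hcol using G.exists_differentiable_col j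
  let F : ℂ → C(Icc 0 (G.ℓ j), Fin 2 → ℂ) := fun w => G.c j w • u 0 w - G.b j w • u 1 w
  have hF : Continuous F :=
    ((G.differentiable_c j).continuous.smul (hu 0).continuous).sub
      ((G.differentiable_b j).continuous.smul (hu 1).continuous)
  have hF' : ∀ w t, t ∈ Icc 0 (G.ℓ j) → G.outerSolution j w t = F w (projIcc 0 (G.ℓ j) hl t) := by
    intro w t ht
    ext i
    rw [projIcc_of_mem hl ht]
    change _ = G.c j w * u 0 w ⟨t, ht⟩ i - G.b j w * u 1 w ⟨t, ht⟩ i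
    simp only [hcol, outerSolution, solution, Pi.add_apply, Pi.smul_apply, smul_eq_mul,
      cons_val_zero, cons_val_one]
    ring
  have h : (fun w => G.outerPairing j z w) = fun w => ∫ t in (0 : ℝ)..G.ℓ j,
      (F z (projIcc 0 (G.ℓ j) hl t) 0 * F w (projIcc 0 (G.ℓ j) hl t) 0 +
        F z (projIcc 0 (G.ℓ j) hl t) 1 * F w (projIcc 0 (G.ℓ j) hl t) 1) := by
    ext w
    refine intervalIntegral.integral_congr fun t ht => ?_
    rw [uIcc_of_le hl] at ht
    simp only [hF' _ t ht]
  rw [h]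
  refine intervalIntegral.continuous_parametric_intervalIntegral_of_continuous' ?_ _ _
  have hp : Continuous fun x : ℂ × ℝ => projIcc 0 (G.ℓ j) hl x.2 :=
    continuous_projIcc.comp continuous_snd
  have h1 : Continuous fun x : ℂ × ℝ => F x.1 (projIcc 0 (G.ℓ j) hl x.2) :=
    (hF.comp continuous_fst).eval hp
  have h2 : Continuous fun x : ℂ × ℝ => F z (projIcc 0 (G.ℓ j) hl x.2) := (F z).continuous.comp hp
  have h3 := fun i => (continuous_apply i).comp h1
  have h4 := fun i => (continuous_apply i).comp h2
  exact ((h4 0).mul (h3 0)).add ((h4 1).mul (h3 1))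

theorem im_eq_zero_of_c_eq_zero (hc : G.c j z = 0) : z.im = 0 := by
  obtain ⟨K, hK, h⟩ := G.exists_outerPairing_conj j z
  have := G.b_mul_c_sub j z (conj z)
  rw [hc, c_conj, hc, h] at this
  simp only [map_zero, mul_zero, sub_zero] at this
  rcases mul_eq_zero.1 this.symm with h1 | h1
  · exact Complex.conj_eq_iff_im.1 (sub_eq_zero.1 h1)
  · exact absurd (Complex.ofReal_eq_zero.1 h1) hK.ne'

/-- The Weyl–Titchmarsh function is a Nevanlinna function. -/
theorem exists_im_m_eq (z : ℂ) : ∃ K : ℝ, 0 < K ∧ (G.m j z).im = K * z.im := by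
  by_cases hc : G.c j z = 0
  -- At a zero of `c_j` the quotient `m_j` has the value zero by convention and `z` is real, so both
  -- sides vanish.
  · exact ⟨1, one_pos, by simp [m, hc, G.im_eq_zero_of_c_eq_zero j hc]⟩
  obtain ⟨K, hK, h⟩ := G.exists_outerPairing_conj j z
  refine ⟨K / Complex.normSq (G.c j z), div_pos hK (Complex.normSq_pos.2 hc), ?_⟩
  have h1 := G.b_mul_c_sub j z (conj z)
  rw [h, b_conj, c_conj] at h1
  have h2 := congrArg Complex.im h1
  have h3 : (G.m j z).im = (G.b j z * conj (G.c j z)).im / Complex.normSq (G.c j z) := by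
    have : G.m j z = G.b j z * conj (G.c j z) * ((Complex.normSq (G.c j z))⁻¹ : ℝ) := by
      rw [m, div_eq_mul_inv, Complex.inv_def]; push_cast; ring
    rw [this, Complex.im_mul_ofReal, div_eq_mul_inv]
  rw [h3]
  simp only [Complex.sub_im, Complex.mul_im, Complex.conj_re, Complex.conj_im, Complex.sub_re,
    Complex.ofReal_re, Complex.ofReal_im] at h2 ⊢
  rw [div_mul_eq_mul_div]
  congr 1
  linarith

theorem im_m_ofReal (x : ℝ) : (G.m j x).im = 0 := by
  obtain ⟨K, -, h⟩ := G.exists_im_m_eq j x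
  simpa using h

/-- The restriction of `m_j` to the real axis. -/
def mReal (x : ℝ) : ℝ := (G.m j x).re

theorem ofReal_mReal (x : ℝ) : (G.mReal j x : ℂ) = G.m j x :=
  Complex.ext rfl (G.im_m_ofReal j x).symm

/-- By `b_mul_c_sub` the difference quotient at `x` is `outerPairing x w / (c x * c w)`. Its limit
is the squared norm of the outer solution over the square of the real number `c x`. -/
theorem exists_hasDerivAt_mReal {x : ℝ} (hc : G.c j x ≠ 0) :
    ∃ d : ℝ, 0 < d ∧ HasDerivAt (G.mReal j) d x := by
  obtain ⟨K, hK, h⟩ := G.exists_outerPairing_conj j x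
  rw [Complex.conj_ofReal] at h
  obtain ⟨r, hr⟩ := Complex.conj_eq_iff_real.1
    ((G.c_conj j x).symm.trans (by rw [Complex.conj_ofReal]))
  have hr0 : r ≠ 0 := by rintro rfl; exact hc (by simpa using hr)
  have hd : HasDerivAt (G.m j) (G.outerPairing j x x / (G.c j x * G.c j x)) (x : ℂ) := by
    rw [hasDerivAt_iff_tendsto_slope]
    have hcont := (G.differentiable_c j).continuous
    have hl : Filter.Tendsto (fun w => G.outerPairing j x w / (G.c j x * G.c j w))
        (nhds (x : ℂ)) (nhds (G.outerPairing j x x / (G.c j x * G.c j x))) :=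
      ((G.continuous_outerPairing j x).tendsto _).div ((hcont.tendsto _).const_mul _)
        (mul_ne_zero hc hc)
    refine (hl.mono_left nhdsWithin_le_nhds).congr' ?_
    filter_upwards [nhdsWithin_le_nhds (hcont.continuousAt.eventually_ne hc),
      self_mem_nhdsWithin] with w hw hwx
    have hwx' : w - x ≠ 0 := sub_ne_zero.2 hwx
    have h1 := G.b_mul_c_sub j x w
    rw [slope_def_field, m, m, div_sub_div _ _ hw hc, div_div,
      div_eq_div_iff (mul_ne_zero hc hw) (mul_ne_zero (mul_ne_zero hw hc) hwx')]
    linear_combination (-(G.c j x * G.c j w)) * h1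
  refine ⟨K / (r * r), div_pos hK (mul_self_pos.2 hr0), ?_⟩
  rw [h, hr] at hd
  have := hd.real_of_complex
  rwa [← Complex.ofReal_mul, ← Complex.ofReal_div, Complex.ofReal_re] at this

theorem eventually_c_ne_zero (z : ℂ) : ∀ᶠ w in nhdsWithin z {z}ᶜ, G.c j w ≠ 0 := by
  have ha : AnalyticOnNhd ℂ (G.c j) univ := fun w _ => (G.differentiable_c j).analyticAt w
  refine (ha z (mem_univ z)).eventually_eq_zero_or_eventually_ne_zero.resolve_left fun h => ?_
  -- If `c_j` vanished identically it would vanish at `I`, but all its zeros are real.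
  have := ha.eqOn_zero_of_preconnected_of_eventuallyEq_zero isPreconnected_univ (mem_univ z) h
    (mem_univ Complex.I)
  simpa using G.im_eq_zero_of_c_eq_zero j this

/-- The numerator does not vanish at a zero of the denominator, so no cancellation occurs and
`|m_j|` tends to infinity there. -/
theorem isPole_iff (z : ℂ) : G.IsPole j z ↔ G.c j z = 0 := by
  have hb := (G.differentiable_b j).analyticAt z
  have hc := (G.differentiable_c j).analyticAt z
  rw [IsPole]
  constructor
  · intro h
    by_contra hne
    exact absurd h (not_lt.2 (hb.div hc hne).meromorphicOrderAt_nonneg)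
  · intro h
    refine (tendsto_cobounded_iff_meromorphicOrderAt_neg (hb.meromorphicAt.div hc.meromorphicAt)).1 ?_
    rw [← tendsto_norm_atTop_iff_cobounded]
    have h1 : Filter.Tendsto (fun w => ‖G.c j w‖) (nhdsWithin z {z}ᶜ) (nhdsWithin 0 (Ioi 0)) := by
      refine tendsto_nhdsWithin_iff.2 ⟨?_, ?_⟩
      · have := ((G.differentiable_c j).continuous.norm.tendsto z).mono_left
          (nhdsWithin_le_nhds (s := {z}ᶜ))
        simpa [h] using this
      · filter_upwards [G.eventually_c_ne_zero j z] with w hw using norm_pos_iff.2 hw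
    have h2 := ((G.differentiable_b j).continuous.norm.tendsto z).mono_left
          (nhdsWithin_le_nhds (s := {z}ᶜ))
    refine (h2.pos_mul_atTop (norm_pos_iff.2 (G.b_ne_zero_of_c_eq_zero j h))
      h1.inv_tendsto_nhdsGT_zero).congr fun w => ?_
    simp [div_eq_mul_inv]

theorem tendsto_abs_mReal_atTop {x : ℝ} (hc : G.c j x = 0) :
    Filter.Tendsto (fun t => |G.mReal j t|) (nhdsWithin x {x}ᶜ) Filter.atTop := by
  have h := (tendsto_cobounded_iff_meromorphicOrderAt_neg
    (((G.differentiable_b j).analyticAt x).meromorphicAt.div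
      ((G.differentiable_c j).analyticAt x).meromorphicAt)).2 ((G.isPole_iff j x).2 hc)
  rw [← tendsto_norm_atTop_iff_cobounded] at h
  have h1 : Filter.Tendsto (fun t : ℝ => (t : ℂ)) (nhdsWithin x {x}ᶜ) (nhdsWithin (x : ℂ) {(x : ℂ)}ᶜ) :=
    Complex.continuous_ofReal.continuousWithinAt.tendsto_nhdsWithin fun t ht => by simpa using ht
  refine (h.comp h1).congr fun t => ?_
  change ‖G.m j t‖ = _
  rw [← ofReal_mReal, Complex.norm_real, Real.norm_eq_abs]

end DiracStarGraph

/-! ### Prüfer phase: poles exist arbitrarily far out on both sides -/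

theorem AbsolutelyContinuousOnInterval.cexp {f : ℝ → ℂ} {a b : ℝ}
    (hf : AbsolutelyContinuousOnInterval f a b) :
    AbsolutelyContinuousOnInterval (fun x => Complex.exp (f x)) a b := by
  obtain ⟨C, hC⟩ := hf.exists_bound
  obtain ⟨K, hK⟩ := (Complex.contDiff_exp (𝕜 := ℝ) (n := 1)).contDiffOn.exists_lipschitzOnWith
    one_ne_zero (convex_closedBall (0 : ℂ) C) (isCompact_closedBall _ _)
  exact hf.of_dist_le K fun x hx y hy => hK.dist_le_mul _ (mem_closedBall_zero_iff.2 (hC x hx)) _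
    (mem_closedBall_zero_iff.2 (hC y hy))

/-- The product of `f` with the integrating factor `exp (-∫ k)` has derivative zero almost
everywhere. -/
theorem eq_mul_exp_integral {f k : ℝ → ℂ} {a b : ℝ} (hf : AbsolutelyContinuousOnInterval f a b)
    (hk : IntervalIntegrable k volume a b)
    (h : ∀ᵐ x, x ∈ uIcc a b → HasDerivAt f (k x * f x) x) :
    f b = f a * Complex.exp (∫ x in a..b, k x) := by
  have hS := intervalIntegral_absolutelyContinuousOnInterval hk
  obtain ⟨C, hC⟩ := (hf.fun_mul_complex hS.neg.cexp).const_of_ae_hasDerivAt_zero (by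
    filter_upwards [h, hk.ae_hasDerivAt_integral] with x h1 h2 hx
    refine ((h1 hx).mul (h2 hx a left_mem_uIcc).neg.cexp).congr_deriv ?_
    simp only [Pi.neg_apply]
    ring)
  have ha := hC a left_mem_uIcc
  have hb := hC b right_mem_uIcc
  simp only [Pi.neg_apply, intervalIntegral.integral_same, neg_zero, Complex.exp_zero,
    mul_one] at ha hb
  rw [ha, ← hb, mul_assoc, ← Complex.exp_add, neg_add_cancel, Complex.exp_zero, mul_one]

theorem exists_ge_eq_of_abs_sub_le {g : ℝ → ℝ} (hg : Continuous g) {a K : ℝ} (ha : 0 < a)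
    (h : ∀ x, |g x - a * x| ≤ K) (y N : ℝ) (hy : g N ≤ y) : ∃ x, N ≤ x ∧ g x = y := by
  -- From `(y + K) / a` onwards the lower bound `a x - K` for `g x` is at least `y`.
  have hM : y ≤ g (max N ((y + K) / a)) := by
    have h1 := (abs_le.1 (h (max N ((y + K) / a)))).1
    have h2 : (y + K) / a * a ≤ max N ((y + K) / a) * a :=
      mul_le_mul_of_nonneg_right (le_max_right _ _) ha.le
    rw [div_mul_cancel₀ _ ha.ne'] at h2
    linarith
  obtain ⟨x, hx, hgx⟩ := intermediate_value_Icc (le_max_left N ((y + K) / a)) hg.continuousOn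
    ⟨hy, hM⟩
  exact ⟨x, hx.1, hgx⟩

namespace DiracStarGraph

open scoped ComplexConjugate

variable {n : ℕ} (G : DiracStarGraph n) (j : Fin n)

/-- The Prüfer variable `f + i f̂` of the second column of the fundamental matrix. -/
def prufer (s t : ℝ) : ℂ := G.col j 1 s t 0 + Complex.I * G.col j 1 s t 1

/-- The potential in complex notation. -/
def complexPotential (t : ℝ) : ℂ := G.q j t - Complex.I * G.p j t

/-- The correction to the free phase. -/
def phaseIntegrand (s t : ℝ) : ℂ :=
  G.complexPotential j t * (conj (G.prufer j s t) / G.prufer j s t)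

variable {t : ℝ}

theorem col_real (k : Fin 2) (s : ℝ) (ht : t ∈ Icc 0 (G.ℓ j)) (i : Fin 2) :
    conj (G.col j k s t i) = G.col j k s t i := by
  rw [← G.col_conj j k s ht i, Complex.conj_ofReal]

theorem conj_prufer (s : ℝ) (ht : t ∈ Icc 0 (G.ℓ j)) :
    conj (G.prufer j s t) = G.col j 1 s t 0 - Complex.I * G.col j 1 s t 1 := by
  simp only [prufer, map_add, map_mul, G.col_real j 1 s ht, Complex.conj_I]
  ring

/-- For real `s` the column is real, so a zero of `f + i f̂` would annihilate the whole column,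
against determinant one. -/
theorem prufer_ne_zero (s : ℝ) (ht : t ∈ Icc 0 (G.ℓ j)) : G.prufer j s t ≠ 0 := by
  intro h
  have h1 := G.conj_prufer j s ht
  rw [h, map_zero] at h1
  rw [prufer] at h
  have h2 : G.col j 1 s t 0 = 0 := by linear_combination (h - h1) / 2
  have h3 : G.col j 1 s t 1 = 0 := by
    linear_combination (-Complex.I / 2) * (h + h1) + G.col j 1 s t 1 * Complex.I_sq
  have := G.det_col j s ht
  rw [h2, h3] at this
  simp at this

theorem continuousOn_prufer (s : ℝ) : ContinuousOn (G.prufer j s) (Icc 0 (G.ℓ j)) := by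
  have h := fun i => (continuous_apply i).comp_continuousOn (G.isSolution_col j 1 s).continuousOn
  exact (h 0).add (continuousOn_const.mul (h 1))

theorem continuous_prufer (ht : t ∈ Icc 0 (G.ℓ j)) : Continuous fun s => G.prufer j s t := by
  have h := fun i => (G.differentiable_col j ht 1 i).continuous.comp Complex.continuous_ofReal
  exact (h 0).add (continuous_const.mul (h 1))

theorem intervalIntegrable_complexPotential :
    IntervalIntegrable (G.complexPotential j) volume 0 (G.ℓ j) := by
  have hp := G.intervalIntegrable_p j
  have hq := G.intervalIntegrable_q j
  have hp' : IntervalIntegrable (fun t => (G.p j t : ℂ)) volume 0 (G.ℓ j) :=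
    ⟨Integrable.ofReal hp.1, Integrable.ofReal hp.2⟩
  have hq' : IntervalIntegrable (fun t => (G.q j t : ℂ)) volume 0 (G.ℓ j) :=
    ⟨Integrable.ofReal hq.1, Integrable.ofReal hq.2⟩
  exact hq'.sub (hp'.const_mul _)

theorem intervalIntegrable_phaseIntegrand (s : ℝ) :
    IntervalIntegrable (G.phaseIntegrand j s) volume 0 (G.ℓ j) := by
  refine (G.intervalIntegrable_complexPotential j).mul_continuousOn ?_
  rw [uIcc_of_le (G.ℓ_pos j).le]
  exact (Complex.continuous_conj.comp_continuousOn (G.continuousOn_prufer j s)).div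
    (G.continuousOn_prufer j s) fun t ht => G.prufer_ne_zero j s ht

theorem norm_phaseIntegrand_le (s t : ℝ) :
    ‖G.phaseIntegrand j s t‖ ≤ ‖G.complexPotential j t‖ := by
  rw [phaseIntegrand, norm_mul, norm_div, Complex.norm_conj]
  exact mul_le_of_le_one_right (norm_nonneg _) (div_self_le_one _)

/-- The Prüfer phase at the outer vertex, relative to the outer boundary condition. -/
def phase (s : ℝ) : ℝ := (∫ t in (0 : ℝ)..G.ℓ j, G.phaseIntegrand j s t).im + G.ℓ j * s - G.α j

theorem continuous_phase : Continuous (G.phase j) := by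
  refine ((Complex.continuous_im.comp ?_).add (continuous_const.mul continuous_id)).sub
    continuous_const
  have hsub : uIoc 0 (G.ℓ j) ⊆ Icc 0 (G.ℓ j) := by
    rw [uIoc_of_le (G.ℓ_pos j).le]; exact Ioc_subset_Icc_self
  refine intervalIntegral.continuous_of_dominated_interval
    (fun s => (intervalIntegrable_iff.1 (G.intervalIntegrable_phaseIntegrand j s)).1)
    (fun s => Filter.Eventually.of_forall fun t _ => G.norm_phaseIntegrand_le j s t)
    (G.intervalIntegrable_complexPotential j).norm
    (Filter.Eventually.of_forall fun t ht => ?_)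
  exact continuous_const.mul ((Complex.continuous_conj.comp (G.continuous_prufer j (hsub ht))).div
    (G.continuous_prufer j (hsub ht)) fun s => G.prufer_ne_zero j s (hsub ht))

theorem abs_phase_sub_le (s : ℝ) :
    |G.phase j s - G.ℓ j * s| ≤ (∫ t in (0 : ℝ)..G.ℓ j, ‖G.complexPotential j t‖) + |G.α j| := by
  have h : G.phase j s - G.ℓ j * s =
      (∫ t in (0 : ℝ)..G.ℓ j, G.phaseIntegrand j s t).im - G.α j := by rw [phase]; ring
  rw [h]
  refine (abs_sub _ _).trans (add_le_add_left ((Complex.abs_im_le_norm _).trans ?_) _)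
  exact intervalIntegral.norm_integral_le_of_norm_le (G.ℓ_pos j).le
    (Filter.Eventually.of_forall fun t _ => G.norm_phaseIntegrand_le j s t)
    (G.intervalIntegrable_complexPotential j).norm

/-- The variable `ζ = f + i f̂` satisfies `ζ' = i s ζ + (q - i p) conj ζ`, and `conj ζ = (conj ζ /
ζ) ζ` turns this into a scalar linear equation with `ζ(0) = i`. -/
theorem prufer_outer (s : ℝ) : G.prufer j s (G.ℓ j) =
    Complex.I * Complex.exp (∫ t in (0 : ℝ)..G.ℓ j, (Complex.I * s + G.phaseIntegrand j s t)) := by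
  have h0 : G.prufer j s 0 = Complex.I := by simp [prufer, col_zero]
  have hcol := G.isSolution_col j 1 s
  refine Eq.trans (b := G.prufer j s 0 * _) (eq_mul_exp_integral (f := G.prufer j s) ((hcol.1.apply 0).add ((hcol.1.apply 1).const_smul Complex.I))
    (intervalIntegrable_const.add (G.intervalIntegrable_phaseIntegrand j s)) ?_) (by rw [h0])
  filter_upwards [hcol.ae_hasDerivAt] with t h1 ht
  have h2 := hasDerivAt_pi.1 (h1 ht)
  rw [uIcc_of_le (G.ℓ_pos j).le] at ht
  refine ((h2 0).add ((h2 1).const_mul Complex.I)).congr_deriv ?_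
  rw [phaseIntegrand, add_mul, mul_assoc (G.complexPotential j t),
    div_mul_cancel₀ _ (G.prufer_ne_zero j s ht), conj_prufer G j s ht, prufer, complexPotential]
  simp only [coef_apply, cons_val_zero, cons_val_one]
  linear_combination (-(s : ℂ) * G.col j 1 s t 1 - G.p j t * G.col j 1 s t 1) * Complex.I_sq

/-- Here `c_j(s) = Re (ζ(ℓ) exp(-iα))`, which by `prufer_outer` is `-sin (phase)` times a positive
factor. -/
theorem c_eq_zero_of_sin_phase {s : ℝ} (h : Real.sin (G.phase j s) = 0) : G.c j s = 0 := by
  have hl := right_mem_Icc.2 (G.ℓ_pos j).le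
  have hreal := (G.c_conj j s).symm.trans (by rw [Complex.conj_ofReal])
  have hc : G.c j s = ((G.prufer j s (G.ℓ j) * Complex.exp (-(G.α j) * Complex.I)).re : ℝ) := by
    rw [Complex.re_eq_add_conj, map_mul, G.conj_prufer j s hl, ← Complex.exp_conj, c_eq, prufer]
    have hE : conj (-(G.α j : ℂ) * Complex.I) = G.α j * Complex.I := by simp
    rw [hE, Complex.exp_mul_I, Complex.exp_mul_I, Complex.cos_neg, Complex.sin_neg,
      Complex.ofReal_cos, Complex.ofReal_sin]
    linear_combination (Complex.sin (G.α j) * G.col j 1 s (G.ℓ j) 1) * Complex.I_sq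
  rw [hc, Complex.ofReal_eq_zero, prufer_outer, mul_assoc, ← Complex.exp_add, Complex.I_mul_re,
    Complex.exp_im, neg_eq_zero]
  refine mul_eq_zero_of_right _ ?_
  refine Eq.trans (congrArg Real.sin ?_) h
  rw [intervalIntegral.integral_add intervalIntegrable_const
    (G.intervalIntegrable_phaseIntegrand j s), intervalIntegral.integral_const, phase]
  simp
  ring

theorem exists_ge_c_eq_zero (N : ℝ) : ∃ x, N ≤ x ∧ G.c j x = 0 := by
  -- The phase is continuous and stays within a bounded distance of `ℓ s`, so beyond `N` it reaches
  -- a multiple of `π`; its monotonicity is not needed.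
  obtain ⟨k, hk⟩ := exists_int_ge (G.phase j N / Real.pi)
  obtain ⟨x, hx, h⟩ := exists_ge_eq_of_abs_sub_le (G.continuous_phase j) (G.ℓ_pos j)
    (G.abs_phase_sub_le j) (k * Real.pi) N ((div_le_iff₀ Real.pi_pos).1 hk)
  exact ⟨x, hx, G.c_eq_zero_of_sin_phase j (by rw [h, Real.sin_int_mul_pi])⟩

theorem exists_le_c_eq_zero (N : ℝ) : ∃ x, x ≤ N ∧ G.c j x = 0 := by
  obtain ⟨k, hk⟩ := exists_int_ge (-G.phase j N / Real.pi)
  obtain ⟨x, hx, h⟩ := exists_ge_eq_of_abs_sub_le (g := fun x => -G.phase j (-x))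
    ((G.continuous_phase j).comp continuous_neg).neg (G.ℓ_pos j)
    (fun x => by
      rw [show -G.phase j (-x) - G.ℓ j * x = -(G.phase j (-x) - G.ℓ j * -x) by ring, abs_neg]
      exact G.abs_phase_sub_le j (-x)) (k * Real.pi) (-N)
    (by simpa using (div_le_iff₀ Real.pi_pos).1 hk)
  refine ⟨-x, by linarith, G.c_eq_zero_of_sin_phase j ?_⟩
  rw [neg_eq_iff_eq_neg.1 h, Real.sin_neg, Real.sin_int_mul_pi, neg_zero]

end DiracStarGraph

/-! ### Sums of increasing functions between poles, and enumeration over the integers -/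

section Enumeration

open Filter Topology

/-- Near the left endpoint `f` is bounded above by `f x₀`, so a large `|f|` can only come from very
negative values. -/
theorem MonotoneOn.tendsto_atBot_of_tendsto_abs {f : ℝ → ℝ} {u v : ℝ} (huv : u < v)
    (hf : MonotoneOn f (Ioo u v)) (h : Tendsto (fun t => |f t|) (𝓝[≠] u) atTop) :
    Tendsto f (𝓝[>] u) atBot := by
  obtain ⟨x₀, hx₀⟩ := exists_between huv
  have h' := h.mono_left (nhdsWithin_mono u fun x (hx : u < x) => hx.ne')
  rw [tendsto_atTop] at h'
  refine tendsto_atBot.2 fun y => ?_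
  filter_upwards [h' (max (-y) (|f x₀| + 1)), Ioo_mem_nhdsGT hx₀.1] with x hx hxm
  have h1 := hf ⟨hxm.1, hxm.2.trans hx₀.2⟩ hx₀ hxm.2.le
  have h2 := le_abs_self (f x₀)
  rcases abs_cases (f x) with h3 | h3 <;> have := max_le_iff.1 hx <;> linarith

theorem MonotoneOn.tendsto_atTop_of_tendsto_abs {f : ℝ → ℝ} {u v : ℝ} (huv : u < v)
    (hf : MonotoneOn f (Ioo u v)) (h : Tendsto (fun t => |f t|) (𝓝[≠] v) atTop) :
    Tendsto f (𝓝[<] v) atTop := by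
  obtain ⟨x₀, hx₀⟩ := exists_between huv
  have h' := h.mono_left (nhdsWithin_mono v fun x (hx : x < v) => hx.ne)
  rw [tendsto_atTop] at h'
  refine tendsto_atTop.2 fun y => ?_
  filter_upwards [h' (max y (|f x₀| + 1)), Ioo_mem_nhdsLT hx₀.2] with x hx hxm
  have h1 := hf hx₀ ⟨hx₀.1.trans hxm.1, hxm.2⟩ hxm.1.le
  have h2 := neg_abs_le (f x₀)
  rcases abs_cases (f x) with h3 | h3 <;> have := max_le_iff.1 hx <;> linarith

/-- A family of real functions that are increasing off their poles. -/
structure IsIncreasingFamily {n : ℕ} (m : Fin n → ℝ → ℝ) (S : Fin n → Set ℝ) : Prop where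
  deriv_pos : ∀ j x, x ∉ S j → ∃ d : ℝ, 0 < d ∧ HasDerivAt (m j) d x
  tendsto_pole : ∀ j, ∀ x ∈ S j, Tendsto (fun t => |m j t|) (𝓝[≠] x) atTop

namespace IsIncreasingFamily

variable {n : ℕ} {m : Fin n → ℝ → ℝ} {S : Fin n → Set ℝ} (h : IsIncreasingFamily m S) {u v : ℝ}

include h in
theorem continuousOn (j : Fin n) (hS : ∀ x ∈ Ioo u v, x ∉ S j) : ContinuousOn (m j) (Ioo u v) :=
  fun x hx => by
    obtain ⟨d, -, hd⟩ := h.deriv_pos j x (hS x hx)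
    exact hd.continuousAt.continuousWithinAt

include h in
theorem strictMonoOn (j : Fin n) (hS : ∀ x ∈ Ioo u v, x ∉ S j) :
    StrictMonoOn (m j) (Ioo u v) := by
  refine strictMonoOn_of_deriv_pos (convex_Ioo u v) (h.continuousOn j hS) fun x hx => ?_
  rw [interior_Ioo] at hx
  obtain ⟨d, hd, hd'⟩ := h.deriv_pos j x (hS x hx)
  rwa [hd'.deriv]

include h in
theorem strictMonoOn_sum (hn : 1 ≤ n) (hS : ∀ x ∈ Ioo u v, ∀ j, x ∉ S j) :
    StrictMonoOn (fun x => ∑ j, m j x) (Ioo u v) := fun _ hx _ hy hxy =>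
  Finset.sum_lt_sum_of_nonempty ⟨⟨0, hn⟩, Finset.mem_univ _⟩ fun j _ =>
    h.strictMonoOn j (fun x hx => hS x hx j) hx hy hxy

-- All terms increase, so the increment of the sum dominates that of each single term. Hence one
-- term with a pole at an endpoint drags the sum to infinity there, whatever the other terms do.
include h in
theorem surjOn_sum (huv : u < v) (hS : ∀ x ∈ Ioo u v, ∀ j, x ∉ S j) (hu : ∃ j, u ∈ S j)
    (hv : ∃ j, v ∈ S j) : SurjOn (fun x => ∑ j, m j x) (Ioo u v) univ := by
  have hmono := fun j => (h.strictMonoOn j fun x hx => hS x hx j).monotoneOn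
  obtain ⟨x₀, hx₀⟩ := exists_between huv
  have hc : ContinuousOn (fun x => ∑ j, m j x) (Ioo u v) :=
    continuousOn_finsetSum _ fun j _ => h.continuousOn j fun x hx => hS x hx j
  have hdiff : ∀ {x y}, x ∈ Ioo u v → y ∈ Ioo u v → x ≤ y → ∀ j,
      m j y - m j x ≤ ∑ j, m j y - ∑ j, m j x := by
    intro x y hx hy hxy j
    rw [← Finset.sum_sub_distrib]
    exact Finset.single_le_sum (f := fun j => m j y - m j x)
      (fun i _ => sub_nonneg.2 (hmono i hx hy hxy)) (Finset.mem_univ j)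
  rintro y -
  obtain ⟨j, hj⟩ := hu
  obtain ⟨i, hi⟩ := hv
  obtain ⟨a, hay, ha⟩ := (((tendsto_atBot.1 ((hmono j).tendsto_atBot_of_tendsto_abs huv
    (h.tendsto_pole j u hj))) (y - ∑ j, m j x₀ + m j x₀)).and (Ioo_mem_nhdsGT hx₀.1)).exists
  obtain ⟨b, hby, hb⟩ := (((tendsto_atTop.1 ((hmono i).tendsto_atTop_of_tendsto_abs huv
    (h.tendsto_pole i v hi))) (y - ∑ j, m j x₀ + m i x₀)).and (Ioo_mem_nhdsLT hx₀.2)).exists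
  have ha' : a ∈ Ioo u v := ⟨ha.1, ha.2.trans hx₀.2⟩
  have hb' : b ∈ Ioo u v := ⟨hx₀.1.trans hb.1, hb.2⟩
  have h1 := hdiff ha' hx₀ ha.2.le j
  have h2 := hdiff hx₀ hb' hb.1.le i
  exact isPreconnected_Ioo.intermediate_value ha' hb' hc
    (show y ∈ Icc (∑ j, m j a) (∑ j, m j b) from ⟨by linarith, by linarith⟩)

end IsIncreasingFamily

/-- Finitely many locally finite sets of reals that are unbounded on both sides can be listed
in nondecreasing order, with multiplicities. -/
theorem exists_monotone_enumeration {n : ℕ} (hn : 1 ≤ n) {S : Fin n → Set ℝ}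
    (hfin : ∀ j a b, (S j ∩ Icc a b).Finite) (hge : ∀ j N, ∃ x, N ≤ x ∧ x ∈ S j)
    (hle : ∀ j N, ∃ x, x ≤ N ∧ x ∈ S j) :
    ∃ D : ℤ → ℝ, Monotone D ∧ ∀ x, {k | D k = x}.encard = {j | x ∈ S j}.encard := by
  -- Labelling each point by the set it comes from makes multiplicities visible. Lexicographically
  -- this is a locally finite linear order without endpoints, hence isomorphic to the integers.
  let ι := {p : ℝ ×ₗ Fin n // (ofLex p).1 ∈ S (ofLex p).2}
  have hIcc : ∀ a b : ι, (Icc a b).Finite := by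
    intro a b
    have hf : (⋃ j : Fin n, (fun x => toLex (x, j)) ''
        (S j ∩ Icc (ofLex a.1).1 (ofLex b.1).1)).Finite :=
      finite_iUnion fun j => (hfin j _ _).image _
    refine Finite.of_finite_image (f := Subtype.val) (hf.subset ?_) Subtype.val_injective.injOn
    rintro _ ⟨p, hp, rfl⟩
    refine mem_iUnion.2 ⟨(ofLex p.1).2, (ofLex p.1).1, ⟨p.2, ?_, ?_⟩, rfl⟩
    · exact Prod.Lex.monotone_fst_ofLex hp.1
    · exact Prod.Lex.monotone_fst_ofLex hp.2
  let _ : LocallyFiniteOrder ι := LocallyFiniteOrder.ofFiniteIcc hIcc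
  let _ : SuccOrder ι := LinearLocallyFiniteOrder.succOrder ι
  let _ : PredOrder ι := LinearLocallyFiniteOrder.predOrder ι
  have : NoMaxOrder ι := ⟨fun a => by
    obtain ⟨x, hx, hxS⟩ := hge ⟨0, hn⟩ ((ofLex a.1).1 + 1)
    refine ⟨⟨toLex (x, ⟨0, hn⟩), hxS⟩, Prod.Lex.lt_iff.2 (Or.inl ?_)⟩
    change (ofLex a.1).1 < x
    linarith⟩
  have : NoMinOrder ι := ⟨fun a => by
    obtain ⟨x, hx, hxS⟩ := hle ⟨0, hn⟩ ((ofLex a.1).1 - 1)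
    refine ⟨⟨toLex (x, ⟨0, hn⟩), hxS⟩, Prod.Lex.lt_iff.2 (Or.inl ?_)⟩
    change x < (ofLex a.1).1
    linarith⟩
  have : Nonempty ι := by
    obtain ⟨x, -, hxS⟩ := hge ⟨0, hn⟩ 0
    exact ⟨⟨toLex (x, ⟨0, hn⟩), hxS⟩⟩
  let e : ι ≃o ℤ := orderIsoIntOfLinearSuccPredArch
  refine ⟨fun k => (ofLex (e.symm k).1).1, fun k l hkl =>
    Prod.Lex.monotone_fst_ofLex (e.symm.monotone hkl), fun x => ?_⟩
  refine Set.encard_congr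
    { toFun := fun k => ⟨(ofLex (e.symm k.1).1).2, ?_⟩
      invFun := fun j => ⟨e ⟨toLex (x, j.1), j.2⟩, by simp⟩
      left_inv := ?_
      right_inv := ?_ }
  · have h1 := (e.symm k.1).2
    have h2 : (ofLex (e.symm k.1).1).1 = x := k.2
    rw [h2] at h1
    exact h1
  · rintro ⟨k, rfl⟩
    apply Subtype.ext
    change e (e.symm k) = k
    simp
  · rintro ⟨j, hj⟩
    apply Subtype.ext
    simp

theorem exists_lt_lt_of_monotone_int {D : ℤ → ℝ} (hD : Monotone D) {x a b : ℝ} (ha : a ∈ range D)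
    (hb : b ∈ range D) (hax : a < x) (hxb : x < b) (hx : x ∉ range D) :
    ∃ k, D k < x ∧ x < D (k + 1) := by
  obtain ⟨i, rfl⟩ := ha
  obtain ⟨l, rfl⟩ := hb
  obtain ⟨k, hk, hmax⟩ := Int.exists_greatest_of_bdd (P := fun k => D k < x)
    ⟨l, fun k hk => le_of_not_ge fun hlk => (hD hlk).not_gt (hk.trans hxb)⟩ ⟨i, hax⟩
  refine ⟨k, hk, lt_of_le_of_ne (not_lt.1 fun hlt => ?_) fun he => hx ⟨_, he.symm⟩⟩
  have := hmax _ hlt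
  omega

/-- The level sets of the sum of an increasing family interlace with the poles. -/
theorem IsIncreasingFamily.exists_interlacing {n : ℕ} (hn : 1 ≤ n) {m : Fin n → ℝ → ℝ}
    {S : Fin n → Set ℝ} (h : IsIncreasingFamily m S) {D : ℤ → ℝ} (hD : Monotone D)
    (hDS : ∀ x, {k | D k = x}.encard = {j | x ∈ S j}.encard)
    (hge : ∀ N, ∃ x, N < x ∧ ∃ j, x ∈ S j) (hle : ∀ N, ∃ x, x < N ∧ ∃ j, x ∈ S j) :
    ∃ B : ℝ → ℤ → ℝ, (∀ y k, D k ≤ B y k ∧ B y k ≤ D (k + 1)) ∧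
      (∀ k, Monotone fun y => B y k) ∧
      (∀ y x, (∃ j, x ∈ S j) → {k | B y k = x}.encard = {j | x ∈ S j}.encard - 1) ∧
      (∀ y x, (∀ j, x ∉ S j) → ∑ j, m j x = y → {k | B y k = x}.encard = 1) ∧
      (∀ y x, (∀ j, x ∉ S j) → ∑ j, m j x ≠ y → {k | B y k = x} = ∅) ∧
      ∀ x, (∀ j, x ∉ S j) → ∃ k, D k < x ∧ x < D (k + 1) ∧
        (∀ x' ∈ Ioo (D k) (D (k + 1)), ∀ j, x' ∉ S j) ∧
        StrictMono (fun y => B y k) ∧ Continuous (fun y => B y k) ∧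
        (∀ y, B y k ∈ Ioo (D k) (D (k + 1)) ∧ ∑ j, m j (B y k) = y) ∧
        InjOn (fun x => ∑ j, m j x) (Ioo (D k) (D (k + 1))) ∧
        (∃ j, D k ∈ S j) ∧ ∃ j, D (k + 1) ∈ S j := by
  have hmem : ∀ x, (∃ j, x ∈ S j) ↔ x ∈ range D := by
    intro x
    have h1 : {k | D k = x}.Nonempty ↔ {j | x ∈ S j}.Nonempty := by
      rw [← encard_ne_zero, ← encard_ne_zero, hDS]
    exact h1.symm
  have hDk : ∀ k, ∃ j, D k ∈ S j := fun k => (hmem _).2 ⟨k, rfl⟩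
  have hgap : ∀ k, ∀ x ∈ Ioo (D k) (D (k + 1)), ∀ j, x ∉ S j := by
    intro k x hx j hj
    obtain ⟨i, rfl⟩ := (hmem x).1 ⟨j, hj⟩
    have h1 := hD.reflect_lt hx.1
    have h2 := hD.reflect_lt hx.2
    omega
  -- A degenerate gap contributes the multiple pole itself, a genuine gap the unique point where the
  -- sum equals `y`.
  have hB : ∀ y k, ∃ x, (D k = D (k + 1) → x = D k) ∧
      (D k < D (k + 1) → x ∈ Ioo (D k) (D (k + 1)) ∧ ∑ j, m j x = y) := by
    intro y k
    rcases (hD ((lt_add_one k).le)).eq_or_lt with he | hlt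
    · exact ⟨D k, fun _ => rfl, fun hlt => absurd he hlt.ne⟩
    · obtain ⟨x, hx, hxy⟩ := h.surjOn_sum hlt (hgap k) (hDk k) (hDk (k + 1)) (mem_univ y)
      exact ⟨x, fun he => absurd he hlt.ne, fun _ => ⟨hx, hxy⟩⟩
  choose B hB1 hB2 using hB
  have hle' : ∀ k, D k ≤ D (k + 1) := fun k => hD ((lt_add_one k).le)
  have hBk : ∀ y k, D k ≤ B y k ∧ B y k ≤ D (k + 1) := by
    intro y k
    rcases (hle' k).eq_or_lt with he | hlt
    · rw [hB1 y k he]; exact ⟨le_rfl, he.le⟩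
    · exact ⟨(hB2 y k hlt).1.1.le, (hB2 y k hlt).1.2.le⟩
  have hmono : ∀ k, Monotone fun y => B y k := by
    intro k y y' hy
    rcases (hle' k).eq_or_lt with he | hlt
    · exact (hB1 y k he).le.trans (hB1 y' k he).ge
    · refine not_lt.1 fun hlt' => ?_
      have := h.strictMonoOn_sum hn (hgap k) (hB2 y' k hlt).1 (hB2 y k hlt).1 hlt'
      simp only [(hB2 y' k hlt).2, (hB2 y k hlt).2] at this
      exact absurd hy (not_le.2 this)
  have hinj := fun k => (h.strictMonoOn_sum hn (hgap k)).injOn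
  have hex : ∀ x, (∀ j, x ∉ S j) → ∃ k, D k < x ∧ x < D (k + 1) := by
    intro x hx
    obtain ⟨b, hb, hbS⟩ := hge x
    obtain ⟨a, ha, haS⟩ := hle x
    exact exists_lt_lt_of_monotone_int hD ((hmem a).1 haS) ((hmem b).1 hbS) ha hb
      fun hr => by obtain ⟨j, hj⟩ := (hmem x).2 hr; exact hx j hj
  have hBgap : ∀ y x k, (∀ j, x ∉ S j) → B y k = x → D k < D (k + 1) := by
    intro y x k hx hk
    refine (hle' k).lt_of_ne fun he => ?_
    rw [hB1 y k he] at hk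
    obtain ⟨j, hj⟩ := hDk k
    exact hx j (hk ▸ hj)
  refine ⟨B, hBk, hmono, fun y x hx => ?_, fun y x hx hxy => ?_, fun y x hx hxy => ?_,
    fun x hx => ?_⟩
  · have hFfin : {k | D k = x}.Finite := by
      rw [← encard_lt_top_iff, hDS, encard_lt_top_iff]
      exact toFinite _
    have hFne : {k | D k = x}.Nonempty := (hmem x).1 hx
    -- Among the indices with `D k = x`, only the last has a nondegenerate gap to its right. This is
    -- the lost unit of multiplicity.
    obtain ⟨K, hK, hKmax⟩ := hFfin.exists_maximal hFne
    have heq : {k | B y k = x} = {k | D k = x} \ {K} := by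
      ext k
      constructor
      · intro hk
        have he : D k = D (k + 1) := by
          by_contra hne
          obtain ⟨j, hj⟩ := hx
          have := hB2 y k ((hle' k).lt_of_ne hne)
          exact hgap k x (hk ▸ this.1) j hj
        have hk' : D k = x := (hB1 y k he).symm.trans hk
        refine ⟨hk', ?_⟩
        rintro rfl
        have := hKmax (show D (k + 1) = x from he ▸ hk') ((lt_add_one k).le)
        omega
      · rintro ⟨hk, hkK⟩
        have hk' : D k = x := hk
        have hK' : D K = x := hK
        have hkK' : k ≠ K := hkK
        have hlt : k < K := lt_of_le_of_ne (le_of_not_ge fun hge => hkK'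
          (le_antisymm (hKmax hk hge) hge)) hkK'
        have he : D k = D (k + 1) :=
          le_antisymm (hle' k) ((hD (Int.add_one_le_of_lt hlt)).trans (hK'.trans hk'.symm).le)
        exact (hB1 y k he).trans hk'
    rw [heq, encard_sdiff_singleton_of_mem hK, hDS]
  · obtain ⟨k, hk1, hk2⟩ := hex x hx
    refine encard_eq_one.2 ⟨k, ?_⟩
    ext i
    constructor
    · intro hi
      have hi' := hB2 y i (hBgap y x i hx hi)
      rw [show B y i = x from hi] at hi'
      have h1 := hD.reflect_lt (hi'.1.1.trans hk2)
      have h2 := hD.reflect_lt (hk1.trans hi'.1.2)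
      change i = k
      omega
    · rintro rfl
      have h1 := hB2 y i (hk1.trans hk2)
      exact hinj i h1.1 ⟨hk1, hk2⟩ (h1.2.trans hxy.symm)
  · refine eq_empty_of_forall_notMem fun k hk => hxy ?_
    have := (hB2 y k (hBgap y x k hx hk)).2
    rwa [show B y k = x from hk] at this
  · obtain ⟨k, hk1, hk2⟩ := hex x hx
    have hlt := hk1.trans hk2
    refine ⟨k, hk1, hk2, hgap k, ?_, ?_, fun y => hB2 y k hlt, hinj k, hDk k, hDk (k + 1)⟩
    · refine (hmono k).strictMono_of_injective fun y y' hy => ?_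
      rw [← (hB2 y k hlt).2, ← (hB2 y' k hlt).2]
      exact congrArg (fun x => ∑ j, m j x) hy
    · refine continuous_iff_continuousAt.2 fun y => ?_
      -- A monotone function whose image contains a neighbourhood of its value cannot jump; here the
      -- image contains the whole gap.
      refine continuousAt_of_monotoneOn_of_image_mem_nhds (s := univ) ((hmono k).monotoneOn _)
        univ_mem ?_
      filter_upwards [isOpen_Ioo.mem_nhds (hB2 y k hlt).1] with x' hx'
      exact ⟨∑ j, m j x', mem_univ _,
        hinj k (hB2 _ k hlt).1 hx' (hB2 _ k hlt).2⟩

end Enumeration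

/-! ### Multiplicity as the dimension of a parameter space -/

namespace LinearPMap

variable {E : Type*} [AddCommGroup E] [Module ℂ E]

theorem mem_map_subtype_eigenKer (A : E →ₗ.[ℂ] E) (z : ℂ) (u : E) :
    u ∈ (A.eigenKer z).map A.domain.subtype ↔ (u, z • u) ∈ A.graph := by
  simp only [eigenKer, Submodule.mem_map, LinearMap.mem_ker, LinearMap.sub_apply,
    LinearMap.smul_apply, sub_eq_zero, Submodule.subtype_apply, mem_graph_iff]
  constructor
  · rintro ⟨y, hy, rfl⟩
    exact ⟨y, rfl, hy⟩
  · rintro ⟨y, rfl, hy⟩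
    exact ⟨y, hy, rfl⟩

theorem multiplicity_eq_finrank (A : E →ₗ.[ℂ] E) (z : ℂ) {F : Type*} [AddCommGroup F] [Module ℂ F]
    [FiniteDimensional ℂ F] (e : F →ₗ[ℂ] E) (he : Function.Injective e) (K : Submodule ℂ F)
    (h : ∀ u, (u, z • u) ∈ A.graph ↔ u ∈ K.map e) :
    A.multiplicity z = Module.finrank ℂ K := by
  have h1 : (A.eigenKer z).map A.domain.subtype = K.map e := by
    ext u
    rw [mem_map_subtype_eigenKer, h]
  let e1 := (Submodule.equivMapOfInjective A.domain.subtype Subtype.val_injective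
    (A.eigenKer z)).trans ((LinearEquiv.ofEq _ _ h1).trans
      (Submodule.equivMapOfInjective e he K).symm)
  have h2 := e1.lift_rank_eq
  rw [← Module.finrank_eq_rank ℂ K, Cardinal.lift_natCast, Cardinal.lift_eq_nat_iff] at h2
  rw [multiplicity, h2, map_natCast]

theorem isEigenvalue_iff_multiplicity_ne_zero (A : E →ₗ.[ℂ] E) (z : ℂ) :
    A.IsEigenvalue z ↔ A.multiplicity z ≠ 0 := by
  rw [IsEigenvalue, multiplicity, Ne, Ne, Cardinal.toENat_eq_zero, Submodule.rank_eq_zero]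

end LinearPMap

/-! ### Eigenspaces of the star graph in terms of vertex data -/

namespace DiracStarGraph

variable {n : ℕ} (G : DiracStarGraph n)

theorem memLp_col (j : Fin n) (k i : Fin 2) (z : ℂ) :
    MemLp (fun x => G.col j k z x i) 2 (G.μ j) := by
  have h := (continuous_apply i).comp_continuousOn (G.isSolution_col j k z).continuousOn
  obtain ⟨C, hC⟩ := isCompact_Icc.exists_bound_of_continuousOn h
  exact MemLp.of_bound (h.aestronglyMeasurable measurableSet_Icc) C
    (ae_restrict_of_forall_mem measurableSet_Icc hC)

/-- The element of `L²(G)` formed by the solutions with given initial values. -/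
def solutionLp (z : ℂ) : (Fin n → Fin 2 → ℂ) →ₗ[ℂ] G.H where
  toFun a := WithLp.toLp 2 fun j => WithLp.toLp 2 fun i =>
    a j 0 • (G.memLp_col j 0 i z).toLp + a j 1 • (G.memLp_col j 1 i z).toLp
  map_add' a a' := by
    ext1 j
    ext1 i
    simp only [Pi.add_apply, add_smul, PiLp.add_apply]
    abel
  map_smul' r a := by
    ext1 j
    ext1 i
    simp only [Pi.smul_apply, smul_assoc, PiLp.smul_apply, RingHom.id_apply, smul_add]

theorem coeFn_solutionLp (z : ℂ) (a : Fin n → Fin 2 → ℂ) (j : Fin n) (i : Fin 2) :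
    (G.solutionLp z a j i : ℝ → ℂ) =ᵐ[G.μ j] fun x => G.solution j z (a j) x i := by
  have h0 := (G.memLp_col j 0 i z).coeFn_toLp
  have h1 := (G.memLp_col j 1 i z).coeFn_toLp
  filter_upwards [h0, h1, Lp.coeFn_add (a j 0 • (G.memLp_col j 0 i z).toLp)
    (a j 1 • (G.memLp_col j 1 i z).toLp), Lp.coeFn_smul (a j 0) (G.memLp_col j 0 i z).toLp,
    Lp.coeFn_smul (a j 1) (G.memLp_col j 1 i z).toLp] with x h0 h1 h2 h3 h4
  refine h2.trans ?_
  rw [Pi.add_apply, h3, h4, Pi.smul_apply, Pi.smul_apply, h0, h1]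
  rfl

/-- Solutions are continuous, so one that vanishes almost everywhere also vanishes at the central
vertex. -/
theorem solutionLp_injective (z : ℂ) : Function.Injective (G.solutionLp z) := by
  refine (injective_iff_map_eq_zero _).2 fun a ha => ?_
  ext j i
  have h1 := G.coeFn_solutionLp z a j i
  rw [ha] at h1
  have h2 := (Lp.coeFn_zero ℂ 2 (G.μ j)).symm.trans h1
  have h3 := Measure.eqOn_Icc_of_ae_eq volume (G.ℓ_pos j).ne h2 continuousOn_const
    ((continuous_apply i).comp_continuousOn (G.isSolution_solution j z (a j)).continuousOn)
    (left_mem_Icc.2 (G.ℓ_pos j).le)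
  exact ((congrFun (G.solution_zero j z (a j)) i).symm.trans h3.symm)

/-- The values at the central vertex of the eigenfunctions of `T_τ`. -/
def vertexData (τ : EReal) (z : ℂ) : Submodule ℂ (Fin n → Fin 2 → ℂ) where
  carrier := {a | (∀ j, a j 0 * G.b j z + a j 1 * G.c j z = 0) ∧ RobinCondition τ fun j _ => a j}
  zero_mem' := by simp [RobinCondition]
  add_mem' := by
    rintro a a' ⟨h1, h2, h3, h4⟩ ⟨h1', h2', h3', h4'⟩
    refine ⟨fun j => ?_, fun j k => ?_, fun h j => ?_, fun h => ?_⟩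
    · simp only [Pi.add_apply]
      linear_combination h1 j + h1' j
    · simp only [Pi.add_apply, h2 j k, h2' j k]
    · simp only [Pi.add_apply, Finset.sum_add_distrib]
      linear_combination h3 h j + h3' h j
    · simp only [Pi.add_apply, Finset.sum_add_distrib, h4 h, h4' h, add_zero]
  smul_mem' := by
    rintro r a ⟨h1, h2, h3, h4⟩
    refine ⟨fun j => ?_, fun j k => ?_, fun h j => ?_, fun h => ?_⟩
    · simp only [Pi.smul_apply, smul_eq_mul]
      linear_combination r * h1 j
    · simp only [Pi.smul_apply, h2 j k]
    · simp only [Pi.smul_apply, smul_eq_mul, ← Finset.mul_sum]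
      linear_combination r * h3 h j
    · simp only [Pi.smul_apply, smul_eq_mul, ← Finset.mul_sum, h4 h, mul_zero]

variable {G}

theorem mem_robinGraph_iff (τ : EReal) (z : ℂ) (u : G.H) :
    (u, z • u) ∈ G.robinGraph τ ↔ u ∈ (G.vertexData τ z).map (G.solutionLp z) := by
  constructor
  · rintro ⟨f, h1, h2, h3, h4, h5⟩
    have hsol : ∀ j, G.IsSolution j z (f j) := by
      refine fun j => ⟨h1 j, ?_⟩
      have h : ∀ i, ∀ᵐ x ∂(G.μ j), G.diracExpr j (f j) x i = z * f j x i := fun i => by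
        filter_upwards [h2 j i, h3 j i, Lp.coeFn_smul z (u j i)] with x hx2 hx3 hx
        rw [← hx3]
        refine Eq.trans hx ?_
        rw [Pi.smul_apply, hx2, smul_eq_mul]
      filter_upwards [ae_all_iff.2 h] with x hx
      exact funext hx
    have heq := fun j => (hsol j).eqOn_solution
    refine ⟨fun j => f j 0, ⟨fun j => ?_, h5⟩, ?_⟩
    · rw [← outerCondition_solution]
      have := h4 j
      rwa [OuterCondition, heq j (right_mem_Icc.2 (G.ℓ_pos j).le)] at this
    · ext1 j
      ext1 i
      apply Lp.ext
      filter_upwards [G.coeFn_solutionLp z (fun j => f j 0) j i, h2 j i, G.ae_Ioo j] with x hx hx2 hm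
      rw [hx, hx2, heq j ⟨hm.1.le, hm.2.le⟩]
  · rintro ⟨a, ⟨h1, h2⟩, rfl⟩
    refine ⟨fun j => G.solution j z (a j), fun j => (G.isSolution_solution j z _).1,
      fun j i => G.coeFn_solutionLp z a j i, fun j i => ?_,
      fun j => (G.outerCondition_solution j z (a j)).2 (h1 j), ?_⟩
    · filter_upwards [G.coeFn_solutionLp z a j i, Lp.coeFn_smul z (G.solutionLp z a j i),
        (G.isSolution_solution j z (a j)).2] with x hx1 hx2 hx3
      refine Eq.trans hx2 ?_
      rw [hx3, Pi.smul_apply, hx1, Pi.smul_apply]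
    · simpa only [RobinCondition, solution_zero] using h2

theorem multiplicity_T (τ : EReal) (z : ℂ) :
    (G.T τ).multiplicity z = Module.finrank ℂ (G.vertexData τ z) :=
  LinearPMap.multiplicity_eq_finrank _ z (G.solutionLp z) (G.solutionLp_injective z) _ fun u => by
    rw [T_graph, mem_robinGraph_iff]

/-- Dividing by `τ` puts the finite and infinite cases into one form, since `(±∞)⁻¹ = 0`. -/
theorem robinCondition_iff (hn : 1 ≤ n) {τ : EReal} (hτ : τ ≠ 0) (f : Fin n → ℝ → Fin 2 → ℂ) :
    RobinCondition τ f ↔ (∀ j k, f j 0 0 = f k 0 0) ∧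
      ∀ j, ((τ⁻¹).toReal : ℂ) * f j 0 0 = ∑ k, f k 0 1 := by
  rw [RobinCondition]
  refine and_congr_right fun _ => ?_
  induction τ with
  | bot => simpa [eq_comm (a := (0 : ℂ))] using ⟨fun h _ => h, fun h => h ⟨0, hn⟩⟩
  | top => simpa [eq_comm (a := (0 : ℂ))] using ⟨fun h _ => h, fun h => h ⟨0, hn⟩⟩
  | coe r =>
    have hr : (r : ℂ) ≠ 0 := by
      intro h
      exact hτ (by rw [Complex.ofReal_eq_zero.1 h, EReal.coe_zero])
    simp only [ne_eq, EReal.coe_ne_top, EReal.coe_ne_bot, not_false_eq_true, and_self,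
      forall_const, EReal.toReal_coe, or_self, false_imp_iff, and_true, ← EReal.coe_inv,
      Complex.ofReal_inv]
    exact forall_congr' fun j => (inv_mul_eq_iff_eq_mul₀ hr).symm

/-- Vertex data of functions that vanish at the central vertex and off the edges in `P`. -/
def extendData (P : Set (Fin n)) [DecidablePred (· ∈ P)] :
    (P → ℂ) →ₗ[ℂ] (Fin n → Fin 2 → ℂ) where
  toFun x j := ![0, if h : j ∈ P then x ⟨j, h⟩ else 0]
  map_add' x y := by
    ext j i
    fin_cases i
    · simp
    · by_cases h : j ∈ P <;> simp [h]
  map_smul' r x := by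
    ext j i
    fin_cases i
    · simp
    · by_cases h : j ∈ P <;> simp [h]

section extendData

variable (P : Set (Fin n)) [DecidablePred (· ∈ P)]

theorem extendData_injective : Function.Injective (extendData P) := by
  intro x y h
  ext j
  simpa [extendData] using congrFun (congrFun h j) 1

theorem mem_range_extendData (a : Fin n → Fin 2 → ℂ) :
    a ∈ LinearMap.range (extendData P) ↔ (∀ j, a j 0 = 0) ∧ ∀ j ∉ P, a j 1 = 0 := by
  constructor
  · rintro ⟨x, rfl⟩
    exact ⟨fun j => rfl, fun j hj => dif_neg hj⟩
  · rintro ⟨h0, h1⟩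
    refine ⟨fun j => a j 1, ?_⟩
    ext j i
    fin_cases i
    · exact (h0 j).symm
    · by_cases h : j ∈ P
      · simp [extendData, h]
      · simp [extendData, h, h1 j h]

theorem sum_extendData (x : P → ℂ) : ∑ j, extendData P x j 1 = ∑ j, x j := by
  have h1 : ∀ j, extendData P x j 1 = if h : j ∈ P then x ⟨j, h⟩ else 0 := fun _ => rfl
  simp only [h1]
  rw [Finset.sum_dite, Finset.sum_const_zero, add_zero]
  refine Finset.sum_bij' (fun j _ => ⟨j.1, (Finset.mem_filter.1 j.2).2⟩)
    (fun j _ => ⟨j.1, by simp [j.2]⟩) ?_ ?_ ?_ ?_ ?_ <;> simp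

end extendData

-- For `τ = 0` all functions vanish at the centre and the edges decouple: the value `f̂_j(v)` is
-- free if `c_j = 0` and zero otherwise.
open Classical in
theorem multiplicity_T_zero (z : ℂ) :
    (G.T 0).multiplicity z = {j | G.c j z = 0}.encard := by
  have h : G.vertexData 0 z = LinearMap.range (extendData {j | G.c j z = 0}) := by
    ext a
    rw [mem_range_extendData]
    constructor
    · rintro ⟨h1, h2, h3, -⟩
      have h0 : ∀ j, a j 0 = 0 := fun j => by simpa using h3 (by simp) j
      refine ⟨h0, fun j hj => ?_⟩
      have := h1 j
      rw [h0 j, zero_mul, zero_add] at this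
      exact (mul_eq_zero.1 this).resolve_right hj
    · rintro ⟨h0, h1⟩
      refine ⟨fun j => ?_, fun j k => by simp [h0], fun _ j => by simp [h0], by simp⟩
      by_cases hc : G.c j z = 0
      · simp [h0, hc]
      · simp [h0, h1 j hc]
  rw [multiplicity_T, h, LinearMap.finrank_range_of_inj (extendData_injective _),
    Module.finrank_fintype_fun_eq_card, ← toFinset_card, ← encard_coe_eq_coe_finsetCard,
    coe_toFinset]

-- On an edge with `c_i = 0` the outer condition forces `f_i(v) = 0`, and continuity carries this to
-- all edges. What remains is the kernel of the sum functional on the pole edges, of codimension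
-- one.
open Classical in
theorem multiplicity_T_of_pole (hn : 1 ≤ n) {τ : EReal} (hτ : τ ≠ 0) {z : ℂ}
    (hz : ∃ j, G.c j z = 0) :
    (G.T τ).multiplicity z = {j | G.c j z = 0}.encard - 1 := by
  set P : Set (Fin n) := {j | G.c j z = 0} with hP
  let s : (P → ℂ) →ₗ[ℂ] ℂ := ∑ j, LinearMap.proj j
  have hs : ∀ x, s x = ∑ j, x j := fun x => by simp [s]
  have h : G.vertexData τ z = (LinearMap.ker s).map (extendData P) := by
    ext a
    constructor
    · rintro ⟨h1, h2⟩
      rw [robinCondition_iff hn hτ] at h2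
      obtain ⟨i, hi⟩ := hz
      have hi0 : a i 0 = 0 := by
        have := h1 i
        rw [hi, mul_zero, add_zero] at this
        exact (mul_eq_zero.1 this).resolve_right (G.b_ne_zero_of_c_eq_zero i hi)
      have h0 : ∀ j, a j 0 = 0 := fun j => (h2.1 j i).trans hi0
      obtain ⟨x, rfl⟩ := (mem_range_extendData P a).2 ⟨h0, fun j hj => by
        have := h1 j
        rw [h0 j, zero_mul, zero_add] at this
        exact (mul_eq_zero.1 this).resolve_right hj⟩
      refine ⟨x, ?_, rfl⟩
      have := h2.2 i
      simp only [hi0, mul_zero, sum_extendData] at this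
      exact (hs x).trans this.symm
    · rintro ⟨x, hx, rfl⟩
      obtain ⟨h0, h1⟩ := (mem_range_extendData P _).1 ⟨x, rfl⟩
      refine ⟨fun j => ?_, (robinCondition_iff hn hτ _).2 ⟨fun j k => by simp [h0], fun j => ?_⟩⟩
      · by_cases hc : G.c j z = 0
        · simp [h0, hc]
        · simp [h0, h1 j hc]
      · simp only [h0, mul_zero, sum_extendData]
        exact ((hs x).symm.trans hx).symm
  have hs0 : s ≠ 0 := by
    obtain ⟨i, hi⟩ := hz
    intro h0
    have := LinearMap.congr_fun h0 (Pi.single ⟨i, hi⟩ 1)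
    rw [hs] at this
    simp at this
  have hdim := Module.Dual.finrank_ker_add_one_of_ne_zero hs0
  rw [Module.finrank_fintype_fun_eq_card] at hdim
  have hP' : P.encard = (Fintype.card P : ℕ∞) := by
    rw [← toFinset_card, ← encard_coe_eq_coe_finsetCard, coe_toFinset]
  rw [multiplicity_T, h, hP', ← hdim,
    ← (Submodule.equivMapOfInjective _ (extendData_injective P) (LinearMap.ker s)).finrank_eq]
  exact (congrArg Nat.cast (Nat.add_sub_cancel _ 1).symm).trans (ENat.natCast_sub _ _)

/-- The common value `x` at the centre determines all the data, with `f̂_j(v) = -m_j x`, and must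
satisfy one scalar linear equation. -/
theorem multiplicity_T_of_not_pole (hn : 1 ≤ n) {τ : EReal} (hτ : τ ≠ 0) {z : ℂ}
    (hz : ∀ j, G.c j z ≠ 0) :
    (∑ j, G.m j z = -(((τ⁻¹).toReal : ℝ) : ℂ) → (G.T τ).multiplicity z = 1) ∧
    (∑ j, G.m j z ≠ -(((τ⁻¹).toReal : ℝ) : ℂ) → (G.T τ).multiplicity z = 0) := by
  have hmem : ∀ a, a ∈ G.vertexData τ z ↔ ∃ x : ℂ, (∀ j, a j = ![x, -(G.m j z * x)]) ∧
      ((τ⁻¹).toReal : ℂ) * x = -((∑ j, G.m j z) * x) := by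
    intro a
    constructor
    · rintro ⟨h1, h2⟩
      rw [robinCondition_iff hn hτ] at h2
      have ha : ∀ j, a j 1 = -(G.m j z * a ⟨0, hn⟩ 0) := fun j => by
        have := h1 j
        rw [h2.1 j ⟨0, hn⟩] at this
        rw [m]
        field_simp [hz j]
        linear_combination this
      refine ⟨a ⟨0, hn⟩ 0, fun j => ?_, ?_⟩
      · ext i
        fin_cases i
        · exact h2.1 j _
        · exact ha j
      · rw [h2.2 ⟨0, hn⟩, Finset.sum_mul, ← Finset.sum_neg_distrib]
        exact Finset.sum_congr rfl fun j _ => ha j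
    · rintro ⟨x, hx, h⟩
      refine ⟨fun j => ?_, (robinCondition_iff hn hτ _).2 ⟨fun j k => by simp [hx], fun j => ?_⟩⟩
      · simp only [hx, cons_val_zero, cons_val_one, m]
        field_simp [hz j]
        ring
      · simp only [hx, cons_val_zero, cons_val_one]
        rw [h, Finset.sum_neg_distrib, Finset.sum_mul]
  rw [multiplicity_T]
  constructor
  · intro h
    have : G.vertexData τ z = Submodule.span ℂ {fun j => ![1, -G.m j z]} := by
      ext a
      rw [hmem, Submodule.mem_span_singleton]
      refine exists_congr fun x => ⟨fun hx => ?_, ?_⟩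
      · ext j i
        rw [hx.1 j]
        fin_cases i <;> simp [mul_comm]
      · rintro rfl
        refine ⟨fun j => ?_, by rw [h]; ring⟩
        ext i
        fin_cases i <;> simp [mul_comm]
    rw [this, finrank_span_singleton]
    · rfl
    · intro h0
      simpa using congrFun (congrFun h0 ⟨0, hn⟩) 0
  · intro h
    have : G.vertexData τ z = ⊥ := by
      refine (Submodule.eq_bot_iff _).2 fun a ha => ?_
      obtain ⟨x, hx, hx'⟩ := (hmem a).1 ha
      have hx0 : x = 0 := by
        by_contra hne
        refine h (mul_right_cancel₀ hne ?_)
        linear_combination hx'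
      ext j i
      rw [hx j, hx0]
      fin_cases i <;> simp
    rw [this, finrank_bot]
    rfl

end DiracStarGraph

/-! ### The level `-1/τ` as a function of an extended real `τ` -/

section NegInv

open Filter Topology

theorem EReal.toReal_inv_coe (r : ℝ) : ((r : EReal)⁻¹).toReal = r⁻¹ := by
  rw [← EReal.coe_inv, EReal.toReal_coe]

theorem EReal.tendsto_toReal_inv_top : Tendsto (fun τ : EReal => (τ⁻¹).toReal) (𝓝 ⊤) (𝓝 0) := by
  refine Metric.tendsto_nhds.2 fun ε hε => ?_
  filter_upwards [Ioi_mem_nhds (EReal.coe_lt_top ε⁻¹)] with τ hτ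
  induction τ with
  | bot => exact absurd hτ (by simp)
  | top => simpa using hε
  | coe r =>
    have hr : ε⁻¹ < r := EReal.coe_lt_coe_iff.1 hτ
    have hr0 : 0 < r := (inv_pos.2 hε).trans hr
    rw [EReal.toReal_inv_coe, Real.dist_eq, sub_zero, abs_of_pos (inv_pos.2 hr0)]
    exact inv_lt_of_inv_lt₀ hε hr

theorem EReal.continuousAt_toReal_inv {τ : EReal} (hτ : τ ≠ 0) :
    ContinuousAt (fun τ : EReal => (τ⁻¹).toReal) τ := by
  induction τ with
  | top => simpa [ContinuousAt] using EReal.tendsto_toReal_inv_top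
  | bot =>
    have h1 : Tendsto (fun τ : EReal => -τ) (𝓝 ⊥) (𝓝 ⊤) := by
      simpa using (continuous_neg (G := EReal)).tendsto ⊥
    have h2 := (EReal.tendsto_toReal_inv_top.comp h1).neg
    simpa [ContinuousAt, Function.comp_def, EReal.inv_neg] using h2
  | coe r =>
    have hr : r ≠ 0 := by rintro rfl; exact hτ rfl
    refine EReal.isOpenEmbedding_coe.continuousAt_iff.1 ?_
    simpa [Function.comp_def, EReal.toReal_inv_coe] using continuousAt_inv₀ hr

theorem EReal.strictMonoOn_neg_toReal_inv {I : Set EReal} (hI : I = Ico ⊥ 0 ∨ I = Ioc 0 ⊤) :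
    StrictMonoOn (fun τ : EReal => -(τ⁻¹).toReal) I := by
  intro τ hτ τ' hτ' h
  rcases hI with rfl | rfl
  · replace hτ' := hτ'.2
    induction τ' with
    | bot => simp at h
    | top => simp at hτ'
    | coe r' =>
      have hr' : r' < 0 := EReal.coe_neg'.1 hτ'
      induction τ with
      | bot => simpa [EReal.toReal_inv_coe] using hr'
      | top => simp at h
      | coe r =>
        have hlt := EReal.coe_lt_coe_iff.1 h
        simpa [EReal.toReal_inv_coe] using (inv_lt_inv_of_neg hr' (hlt.trans hr')).2 hlt
  · replace hτ := hτ.1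
    induction τ with
    | bot => simp at hτ
    | top => simp at h
    | coe r =>
      have hr : 0 < r := EReal.coe_pos.1 hτ
      induction τ' with
      | bot => simp at h
      | top => simpa [EReal.toReal_inv_coe] using hr
      | coe r' =>
        have hlt := EReal.coe_lt_coe_iff.1 h
        simpa [EReal.toReal_inv_coe] using (inv_lt_inv₀ (hr.trans hlt) hr).2 hlt

end NegInv

/-! ### Eigenvalue enumerations -/

namespace LinearPMap

variable {E : Type*} [AddCommGroup E] [Module ℂ E] {A : E →ₗ.[ℂ] E}

theorem IsEigenvalueEnumeration.shift {a : ℤ → ℝ} (h : A.IsEigenvalueEnumeration a) :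
    A.IsEigenvalueEnumeration fun k => a (k + 1) := by
  refine ⟨fun k l hkl => h.1 (by omega), fun z => ?_⟩
  rw [← h.2 z]
  exact Set.encard_congr ((Equiv.addRight (1 : ℤ)).subtypeEquiv fun _ => Iff.rfl)

theorem isEigenvalueEnumeration_of_real {a : ℤ → ℝ} (ha : Monotone a)
    (h : ∀ x : ℝ, {k | a k = x}.encard = A.multiplicity x)
    (h' : ∀ z : ℂ, z.im ≠ 0 → A.multiplicity z = 0) : A.IsEigenvalueEnumeration a := by
  refine ⟨ha, fun z => ?_⟩
  by_cases hz : z.im = 0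
  · obtain ⟨x, rfl⟩ : ∃ x : ℝ, (x : ℂ) = z := ⟨z.re, Complex.ext rfl (by simp [hz])⟩
    simpa using h x
  · rw [h' z hz, encard_eq_zero]
    refine eq_empty_of_forall_notMem fun k hk => hz ?_
    rw [← show (a k : ℂ) = z from hk, Complex.ofReal_im]

end LinearPMap

/-! ### Poles, enumerations, interlacing and eigenvalue branches -/

namespace DiracStarGraph

open Filter Topology

variable {n : ℕ} (G : DiracStarGraph n)

/-- The real poles of `m_j`. -/
def poles (j : Fin n) : Set ℝ := {x | G.c j x = 0}

/-- An accumulation point would contradict that zeros of `c_j` are isolated. -/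
theorem finite_poles_inter_Icc (j : Fin n) (a b : ℝ) : (G.poles j ∩ Icc a b).Finite := by
  by_contra hinf
  obtain ⟨x, -, hx⟩ := Set.Infinite.exists_accPt_of_subset_isCompact hinf isCompact_Icc
    inter_subset_right
  have h1 : Tendsto (fun t : ℝ => (t : ℂ)) (𝓝[≠] x) (𝓝[≠] (x : ℂ)) :=
    Complex.continuous_ofReal.continuousWithinAt.tendsto_nhdsWithin fun t ht => by simpa using ht
  obtain ⟨t, ht, ht'⟩ := ((accPt_iff_frequently_nhdsNE.1 hx).and_eventually
    (h1.eventually (G.eventually_c_ne_zero j x))).exists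
  exact ht' ht.1

theorem isIncreasingFamily : IsIncreasingFamily G.mReal G.poles :=
  ⟨fun j _ hx => G.exists_hasDerivAt_mReal j hx, fun j _ hx => G.tendsto_abs_mReal_atTop j hx⟩

theorem ofReal_sum_mReal (x : ℝ) : ((∑ j, G.mReal j x : ℝ) : ℂ) = ∑ j, G.m j x := by
  push_cast
  exact Finset.sum_congr rfl fun j _ => G.ofReal_mReal j x

/-- Each `Im m_j(z)` is a positive multiple of `Im z`, so the imaginary parts cannot cancel in the
sum. -/
theorem im_eq_zero_of_sum_m_eq (hn : 1 ≤ n) {z : ℂ} {r : ℝ} (h : ∑ j, G.m j z = r) :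
    z.im = 0 := by
  choose K hK hm using fun j => G.exists_im_m_eq j z
  have h1 := congrArg Complex.im h
  rw [Complex.im_sum, Complex.ofReal_im, Finset.sum_congr rfl fun j _ => hm j,
    ← Finset.sum_mul] at h1
  refine (mul_eq_zero.1 h1).resolve_left (Finset.sum_pos (fun j _ => hK j) ?_).ne'
  exact ⟨⟨0, hn⟩, Finset.mem_univ _⟩

variable {G}

theorem isWeylSolution_iff {τ : EReal} {z : ℂ} : G.IsWeylSolution τ z ↔
    (∀ j, G.c j z ≠ 0) ∧ ∑ j, G.m j z = -(((τ⁻¹).toReal : ℝ) : ℂ) := by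
  simp only [IsWeylSolution, isPole_iff, ne_eq]

theorem isWeylSolution_ofReal_iff {τ : EReal} {x : ℝ} : G.IsWeylSolution τ x ↔
    (∀ j, x ∉ G.poles j) ∧ ∑ j, G.mReal j x = -(τ⁻¹).toReal := by
  rw [isWeylSolution_iff, ← ofReal_sum_mReal, ← Complex.ofReal_neg, Complex.ofReal_inj]
  rfl

theorem IsWeylSolution.im_eq_zero (hn : 1 ≤ n) {τ : EReal} {z : ℂ} (h : G.IsWeylSolution τ z) :
    z.im = 0 :=
  G.im_eq_zero_of_sum_m_eq hn (r := -(τ⁻¹).toReal) (by rw [h.2, Complex.ofReal_neg])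

theorem multiplicity_eq_zero_of_im_ne_zero (hn : 1 ≤ n) (τ : EReal) {z : ℂ} (hz : z.im ≠ 0) :
    (G.T τ).multiplicity z = 0 := by
  have hc : ∀ j, G.c j z ≠ 0 := fun j hj => hz (G.im_eq_zero_of_c_eq_zero j hj)
  by_cases hτ : τ = 0
  · subst hτ
    rw [multiplicity_T_zero, encard_eq_zero]
    exact eq_empty_of_forall_notMem hc
  · exact (multiplicity_T_of_not_pole hn hτ hc).2 fun h =>
      hz (IsWeylSolution.im_eq_zero hn (isWeylSolution_iff.2 ⟨hc, h⟩))

theorem exists_pole_enumeration (hn : 1 ≤ n) (G : DiracStarGraph n) :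
    ∃ D : ℤ → ℝ, Monotone D ∧ ∀ x, {k | D k = x}.encard = {j | x ∈ G.poles j}.encard :=
  exists_monotone_enumeration hn G.finite_poles_inter_Icc (fun j => G.exists_ge_c_eq_zero j)
    fun j => G.exists_le_c_eq_zero j

theorem exists_lt_pole (hn : 1 ≤ n) (N : ℝ) : ∃ x, N < x ∧ ∃ j, x ∈ G.poles j := by
  obtain ⟨x, hx, hc⟩ := G.exists_ge_c_eq_zero ⟨0, hn⟩ (N + 1)
  exact ⟨x, by linarith, _, hc⟩

theorem exists_pole_lt (hn : 1 ≤ n) (N : ℝ) : ∃ x, x < N ∧ ∃ j, x ∈ G.poles j := by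
  obtain ⟨x, hx, hc⟩ := G.exists_le_c_eq_zero ⟨0, hn⟩ (N - 1)
  exact ⟨x, by linarith, _, hc⟩

/-- One list `D` serves all `τ` at once, which makes the enumerations directly comparable index by
index. -/
theorem exists_eigenvalueEnumerations (hn : 1 ≤ n) (G : DiracStarGraph n) :
    ∃ (D : ℤ → ℝ) (B : EReal → ℤ → ℝ), (G.T 0).IsEigenvalueEnumeration D ∧
      (∀ τ, τ ≠ 0 → (G.T τ).IsEigenvalueEnumeration (B τ)) ∧
      (∀ τ k, D k ≤ B τ k ∧ B τ k ≤ D (k + 1)) ∧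
      ∀ τ τ', -(τ⁻¹).toReal ≤ -(τ'⁻¹).toReal → ∀ k, B τ k ≤ B τ' k := by
  obtain ⟨D, hD, hDS⟩ := exists_pole_enumeration hn G
  obtain ⟨B, hB, hmono, hpole, hsol, hns, -⟩ := G.isIncreasingFamily.exists_interlacing hn hD hDS
    (exists_lt_pole hn) (exists_pole_lt hn)
  refine ⟨D, fun τ => B (-(τ⁻¹).toReal), ?_, fun τ hτ => ?_, fun τ => hB _,
    fun τ τ' h k => hmono k h⟩
  · refine LinearPMap.isEigenvalueEnumeration_of_real hD (fun x => ?_)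
      fun z => multiplicity_eq_zero_of_im_ne_zero hn 0
    rw [multiplicity_T_zero, hDS]
    rfl
  · refine LinearPMap.isEigenvalueEnumeration_of_real
      (monotone_int_of_le_succ fun k => (hB _ k).2.trans (hB _ (k + 1)).1) (fun x => ?_)
      fun z => multiplicity_eq_zero_of_im_ne_zero hn τ
    by_cases hx : ∃ j, x ∈ G.poles j
    · rw [hpole _ x hx, multiplicity_T_of_pole hn hτ hx]
      rfl
    · push Not at hx
      have hm := multiplicity_T_of_not_pole hn hτ (z := (x : ℂ)) hx
      rw [← ofReal_sum_mReal, ← Complex.ofReal_neg, Ne, Complex.ofReal_inj] at hm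
      by_cases he : ∑ j, G.mReal j x = -(τ⁻¹).toReal
      · rw [hsol _ x hx he, hm.1 he]
      · rw [hns _ x hx he, hm.2 he, encard_empty]

theorem eigenvaluesInterlace (hn : 1 ≤ n) (G : DiracStarGraph n) (τ₁ τ₂ : EReal) :
    (G.T τ₁).EigenvaluesInterlace (G.T τ₂) := by
  obtain ⟨D, B, hD, hB, hDB, hmono⟩ := exists_eigenvalueEnumerations hn G
  by_cases h1 : τ₁ = 0
  · subst h1
    by_cases h2 : τ₂ = 0
    · subst h2
      exact ⟨D, D, hD, hD, fun k => ⟨le_rfl, hD.1 (lt_add_one k).le⟩⟩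
    · exact ⟨D, B τ₂, hD, hB τ₂ h2, hDB τ₂⟩
  by_cases h2 : τ₂ = 0
  · subst h2
    exact ⟨B τ₁, _, hB τ₁ h1, hD.shift, fun k => ⟨(hDB τ₁ k).2, (hDB τ₁ (k + 1)).1⟩⟩
  -- The operator with the lower level comes first in each gap. If that is `τ₂`, its list has to be
  -- shifted by one index.
  rcases le_total (-(τ₁⁻¹).toReal) (-(τ₂⁻¹).toReal) with h | h
  · exact ⟨B τ₁, B τ₂, hB τ₁ h1, hB τ₂ h2, fun k =>
      ⟨hmono _ _ h k, (hDB τ₂ k).2.trans (hDB τ₁ (k + 1)).1⟩⟩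
  · exact ⟨B τ₁, _, hB τ₁ h1, (hB τ₂ h2).shift, fun k =>
      ⟨(hDB τ₁ k).2.trans (hDB τ₂ (k + 1)).1, hmono _ _ h (k + 1)⟩⟩

theorem exists_unique_branch (hn : 1 ≤ n) {I : Set EReal}
    (hI : I = Ico ⊥ 0 ∨ I = Ioc 0 ⊤) {τ₀ : EReal} (hτ₀ : τ₀ ∈ I) {z₀ : ℂ}
    (hz₀ : G.IsWeylSolution τ₀ z₀) :
    ∃ lam : EReal → ℝ, (lam τ₀ : ℂ) = z₀ ∧ ContinuousOn lam I ∧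
      (∀ τ ∈ I, G.IsWeylSolution τ (lam τ)) ∧ StrictMonoOn lam I ∧
      ∀ mu : EReal → ℝ, (mu τ₀ : ℂ) = z₀ → ContinuousOn mu I →
        (∀ τ ∈ I, G.IsWeylSolution τ (mu τ)) → EqOn mu lam I := by
  obtain ⟨x₀, rfl⟩ : ∃ x : ℝ, (x : ℂ) = z₀ :=
    ⟨z₀.re, Complex.ext rfl (by simp [hz₀.im_eq_zero hn])⟩
  rw [isWeylSolution_ofReal_iff] at hz₀
  obtain ⟨D, hD, hDS⟩ := exists_pole_enumeration hn G
  obtain ⟨B, -, -, -, -, -, hgap⟩ := G.isIncreasingFamily.exists_interlacing hn hD hDS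
    (exists_lt_pole hn) (exists_pole_lt hn)
  obtain ⟨k, hk1, hk2, hnp, hmono, hcont, hB, hinj, ⟨i, hi⟩, ⟨i', hi'⟩⟩ := hgap x₀ hz₀.1
  have hI0 : ∀ τ ∈ I, τ ≠ 0 := by
    rcases hI with rfl | rfl
    · exact fun τ hτ => hτ.2.ne
    · exact fun τ hτ => hτ.1.ne'
  have hIc : IsPreconnected I := by
    rcases hI with rfl | rfl
    · exact isPreconnected_Ico
    · exact isPreconnected_Ioc
  refine ⟨fun τ => B (-(τ⁻¹).toReal) k, ?_, fun τ hτ => ?_, fun τ _ => ?_, fun τ hτ τ' hτ' h => ?_,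
    fun mu h0 hmu hsol τ hτ => ?_⟩
  · exact congrArg _ (hinj (hB _).1 ⟨hk1, hk2⟩ ((hB _).2.trans hz₀.2.symm))
  · exact (hcont.continuousAt.comp
      (EReal.continuousAt_toReal_inv (hI0 τ hτ)).neg).continuousWithinAt
  · exact isWeylSolution_ofReal_iff.2 ⟨hnp _ (hB _).1, (hB _).2⟩
  · exact hmono (EReal.strictMonoOn_neg_toReal_inv hI hτ hτ' h)
  -- The range of a competing branch is an interval that contains `x₀` and no pole, so it stays
  -- between the poles `D k` and `D (k + 1)`, where the sum is injective.
  · have hconn := (hIc.image mu hmu).ordConnected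
    have h0' : x₀ ∈ mu '' I := ⟨τ₀, hτ₀, Complex.ofReal_injective h0⟩
    have hmem : mu τ ∈ mu '' I := mem_image_of_mem mu hτ
    have havoid : ∀ x ∈ mu '' I, ∀ j, x ∉ G.poles j := by
      rintro _ ⟨σ, hσ, rfl⟩
      exact (isWeylSolution_ofReal_iff.1 (hsol σ hσ)).1
    refine hinj ⟨?_, ?_⟩ (hB _).1
      ((isWeylSolution_ofReal_iff.1 (hsol τ hτ)).2.trans (hB _).2.symm)
    · by_contra hle
      exact havoid _ (hconn.out hmem h0' ⟨not_lt.1 hle, hk1.le⟩) i hi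
    · by_contra hle
      exact havoid _ (hconn.out h0' hmem ⟨hk2.le, not_lt.1 hle⟩) i' hi'

theorem IsWeylSolution.multiplicity_eq_one (hn : 1 ≤ n) {τ : EReal} (hτ : τ ≠ 0) {z : ℂ}
    (h : G.IsWeylSolution τ z) : (G.T τ).multiplicity z = 1 := by
  rw [isWeylSolution_iff] at h
  exact (multiplicity_T_of_not_pole hn hτ h.1).1 h.2

theorem multiplicity_T_of_isPole (hn : 1 ≤ n) {τ : EReal} (hτ : τ ≠ 0) {z : ℂ}
    (hz : ∃ j, G.IsPole j z) :
    (G.T τ).multiplicity z = ({j | G.IsPole j z}.ncard - 1 : ℕ) := by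
  simp only [isPole_iff] at hz ⊢
  rw [multiplicity_T_of_pole hn hτ hz, ← (toFinite _).cast_ncard_eq, ENat.natCast_sub, Nat.cast_one]

theorem isEigenvalue_iff (hn : 1 ≤ n) {τ : EReal} (hτ : τ ≠ 0) (z : ℂ) :
    (G.T τ).IsEigenvalue z ↔ G.IsWeylSolution τ z ∨ 2 ≤ {j | G.IsPole j z}.ncard := by
  rw [LinearPMap.isEigenvalue_iff_multiplicity_ne_zero]
  by_cases hz : ∃ j, G.IsPole j z
  · have h1 : ¬ G.IsWeylSolution τ z := fun h => hz.elim fun j hj => h.1 j hj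
    rw [multiplicity_T_of_isPole hn hτ hz, or_iff_right h1, Nat.cast_ne_zero]
    omega
  · have h1 : {j | G.IsPole j z}.ncard = 0 := by
      rw [ncard_eq_zero]
      exact eq_empty_of_forall_notMem fun j hj => hz ⟨j, hj⟩
    rw [h1, or_iff_left (by omega)]
    refine ⟨fun h => ?_, fun h => by rw [h.multiplicity_eq_one hn hτ]; exact one_ne_zero⟩
    have hc : ∀ j, G.c j z ≠ 0 := fun j hj => hz ⟨j, (G.isPole_iff j z).2 hj⟩
    exact isWeylSolution_iff.2 ⟨hc, by_contra fun hne =>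
      h ((multiplicity_T_of_not_pole hn hτ hc).2 hne)⟩

end DiracStarGraph

end

theorem theorem5p3 {n : ℕ} (hn : 1 ≤ n) (G : DiracStarGraph n) :
    -- the eigenvalues of `T_τ` are of two types
    (∀ τ : EReal, τ ≠ 0 → ∀ z : ℂ,
      (G.T τ).IsEigenvalue z ↔ G.IsWeylSolution τ z ∨ 2 ≤ {j | G.IsPole j z}.ncard) ∧
    -- type i): simplicity
    (∀ τ : EReal, τ ≠ 0 → ∀ z : ℂ, G.IsWeylSolution τ z → (G.T τ).multiplicity z = 1) ∧
    -- type i): each solution is a strictly increasing function of `τ` on `[-∞, 0)` and `(0, ∞]`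
    (∀ I : Set EReal, I = Set.Ico ⊥ 0 ∨ I = Set.Ioc 0 ⊤ →
      ∀ τ₀ ∈ I, ∀ z₀ : ℂ, G.IsWeylSolution τ₀ z₀ →
        ∃ lam : EReal → ℝ,
          (lam τ₀ : ℂ) = z₀ ∧ ContinuousOn lam I ∧ (∀ τ ∈ I, G.IsWeylSolution τ (lam τ)) ∧
          StrictMonoOn lam I ∧
          ∀ mu : EReal → ℝ, (mu τ₀ : ℂ) = z₀ → ContinuousOn mu I →
            (∀ τ ∈ I, G.IsWeylSolution τ (mu τ)) → Set.EqOn mu lam I) ∧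
    -- type ii): common poles of exactly `ν + 1` of the `m_j`; no dependence on `τ`
    (∀ z : ℂ, ∀ ν : ℕ, 1 ≤ ν → {j | G.IsPole j z}.ncard = ν + 1 →
      ∀ τ : EReal, τ ≠ 0 → (G.T τ).multiplicity z = ν) ∧
    -- interlacing
    (∀ τ₁ τ₂ : EReal, (G.T τ₁).EigenvaluesInterlace (G.T τ₂)) := by
  refine ⟨fun τ hτ z => DiracStarGraph.isEigenvalue_iff hn hτ z,
    fun τ hτ z hz => hz.multiplicity_eq_one hn hτ,
    fun I hI τ₀ hτ₀ z₀ hz₀ => DiracStarGraph.exists_unique_branch hn hI hτ₀ hz₀,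
    fun z ν hν hz τ hτ => ?_, DiracStarGraph.eigenvaluesInterlace hn G⟩
  have hne : {j | G.IsPole j z}.Nonempty := by
    rw [← Set.ncard_pos, hz]
    exact ν.succ_pos
  rw [DiracStarGraph.multiplicity_T_of_isPole hn hτ hne, hz, Nat.add_sub_cancel]
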